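/- Let $f\colon\mathbb R^d\to[0,\infty)$ be a proper log-concave function, that is, an upper semi-continuous log-concave function of finite positive integral. For $t\ge 0$ put $$\psi_s(t)=\frac{s}{2}\left[\sqrt{1+4\left(\tfrac ts\right)^2}-\ln\!\left(\frac{1+\sqrt{1+4(t/s)^2}}{2}\right)-1\right]\quad (0<s<\infty),\qquad \psi_\infty(t)=t^2,$$ and for $s\in(0,\infty]$ let $$\mathcal F_s=\left\{x\mapsto \alpha e^{-\psi_s(|A(x-a)|)} : A\in \mathrm{GL}(d),\ \alpha>0,\ a\in\mathbb R^d\right\},$$ where $|\cdot|$ is the Euclidean norm. The elements of $\mathcal F_\infty$ are called Gaussian densities (they need not be normalized). Consider the problem $$(P_s)\qquad \min_{\ell\in\mathcal F_s}\int_{\mathbb R^d}\ell\quad\text{subject to}\quad f\le \ell \text{ pointwise on }\mathbb R^d .$$ For every $s\in(0,\infty)$ the problem $(P_s)$ has a unique solution, called the Löwner $s$-function of $f$ and denoted by $L_s$. The following assertions are equivalent: 1. $\displaystyle\liminf_{s\to\infty}\int_{\mathbb R^d}L_s<\infty$; 2. there exists a Gaussian density $G$ such that $f\le G$; 3. there exists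 a unique solution to the problem $(P_\infty)$. Moreover, if $(P_\infty)$ has a solution $G$, then $L_s\to G$ uniformly on $\mathbb R^d$ as $s\to\infty$. -/

import Mathlib

open scoped NNReal ENNReal

/-- `f : ℝᵈ → [0, ∞)` is a proper log-concave function: it is log-concave (that is, `f = e^{-φ}`
with `φ` convex and possibly `+∞`, written multiplicatively so that zeros of `f` are allowed),
upper semicontinuous, and has finite positive integral. -/
structure IsProperLogConcave {d : ℕ} (f : EuclideanSpace ℝ (Fin d) → ℝ) : Prop where
  nonneg : ∀ x, 0 ≤ f x
  logConcave : ∀ (x y : EuclideanSpace ℝ (Fin d)) (a b : ℝ), 0 ≤ a → 0 ≤ b → a + b = 1 →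
    f x ^ a * f y ^ b ≤ f (a • x + b • y)
  upperSemicontinuous : UpperSemicontinuous f
  integrable : MeasureTheory.Integrable f
  integral_pos : 0 < ∫ x, f x

/-- The functions `ψ_s : [0, ∞) → [0, ∞)` for `s ∈ [0, ∞]`; only the values at `t ≥ 0` are used. -/
noncomputable def lownerPsi (s : ℝ≥0∞) (t : ℝ) : ℝ :=
  if s = 0 then t
  else if s = ∞ then t ^ 2
  else s.toReal / 2 *
    (√(1 + 4 * (t / s.toReal) ^ 2)
      - Real.log ((1 + √(1 + 4 * (t / s.toReal) ^ 2)) / 2) - 1)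

/-- The class of all functions `x ↦ α e^{-ψ(|A(x - a)|)}` on `ℝᵈ` with `A` an invertible linear
map, `α > 0` and `a ∈ ℝᵈ`, where `|·|` is the Euclidean norm. -/
def positionClass (d : ℕ) (ψ : ℝ → ℝ) : Set (EuclideanSpace ℝ (Fin d) → ℝ) :=
  {l | ∃ (A : EuclideanSpace ℝ (Fin d) ≃L[ℝ] EuclideanSpace ℝ (Fin d)) (α : ℝ)
      (a : EuclideanSpace ℝ (Fin d)),
      0 < α ∧ l = fun x => α * Real.exp (-ψ ‖A (x - a)‖)}

/-- Gaussian densities, not necessarily normalized: the functions `x ↦ α e^{-|A(x - a)|²}`. -/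
noncomputable def gaussianDensities (d : ℕ) : Set (EuclideanSpace ℝ (Fin d) → ℝ) :=
  positionClass d (lownerPsi ∞)

/-- `l` solves the problem: minimize `∫ l` over the class of `ψ_s`, subject to `f ≤ l`. Integrals of
nonnegative functions are taken with values in `[0, ∞]`. -/
structure IsLownerSolution {d : ℕ} (s : ℝ≥0∞) (f l : EuclideanSpace ℝ (Fin d) → ℝ) : Prop where
  mem : l ∈ positionClass d (lownerPsi s)
  le : f ≤ l
  minimal : ∀ l' ∈ positionClass d (lownerPsi s), f ≤ l' →
    ∫⁻ x, ENNReal.ofReal (l x) ≤ ∫⁻ x, ENNReal.ofReal (l' x)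

/-- The Löwner `s`-function of `f`: the solution of the minimization problem for `ψ_s` (an arbitrary
function if there is none). -/
noncomputable def lownerFunction {d : ℕ} (s : ℝ≥0) (f : EuclideanSpace ℝ (Fin d) → ℝ) :
    EuclideanSpace ℝ (Fin d) → ℝ :=
  Classical.epsilon (IsLownerSolution (s : ℝ≥0∞) f)

open MeasureTheory Filter Topology

/-! A dilation of the argument of `ψ` can be absorbed into `A`, so `ψ_s` may be replaced by
`rescaledPsi s`, which increases with `s` and lies between `t ^ 2 - t ^ 4 / s` and `t ^ 2`. The
integral of a position is `α / |det A|` times a constant depending only on the profile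
(`lintegral_positionFun`). Hence every problem minimizes the same quantity `relVolume`, and only the
constraint `f ≤ ℓ` changes with `s`.

Existence is compactness: `f` is bounded below by some `m > 0` on a ball, and positions above `m`
there with bounded relative volume have parameters in a compact set (`exists_isCompact_param`).
Uniqueness is strict log-concavity of the determinant (`norm_eq_or_exists_interpolation`) when the
linear parts differ by more than an isometry, and a dilation argument
(`exists_relVolume_lt_of_ne_center`) when only the centres differ. For finite `s` feasible positions
exist, because `f` decays exponentially and `rescaledPsi s` grows at most linearly.

For the limit, a Gaussian above `f` stays above `f` when `t ^ 2` is replaced by the smaller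
`rescaledPsi s`, so it bounds the relative volume of every `L_s`. Conversely, bounded relative
volumes along `s → ∞` give subsequential limits of the parameters, which are feasible Gaussians
(`IsProperLogConcave.exists_subseq`). If the bound is the optimal Gaussian value, such a limit is
optimal, hence equal to `G`. Uniform convergence follows from convergence of the parameters and a
common exponential tail bound. -/

/-- The radial profiles `ψ` for which the minimization problem is well behaved; only the values of
`ψ` on `[0, ∞)` matter. -/
structure IsRadialProfile (ψ : ℝ → ℝ) : Prop where
  continuous : Continuous ψ
  strictMonoOn : StrictMonoOn ψ (Set.Ici 0)
  convexOn : ConvexOn ℝ (Set.Ici 0) ψ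
  map_zero : ψ 0 = 0

/-! ### Growth of convex radial profiles -/

namespace IsRadialProfile

variable {ψ : ℝ → ℝ}

lemma monotoneOn (h : IsRadialProfile ψ) : MonotoneOn ψ (Set.Ici 0) := h.strictMonoOn.monotoneOn

lemma nonneg (h : IsRadialProfile ψ) {t : ℝ} (ht : 0 ≤ t) : 0 ≤ ψ t := by
  have := h.monotoneOn Set.self_mem_Ici ht ht
  rwa [h.map_zero] at this

lemma pos (h : IsRadialProfile ψ) {t : ℝ} (ht : 0 < t) : 0 < ψ t := by
  have := h.strictMonoOn Set.self_mem_Ici ht.le ht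
  rwa [h.map_zero] at this

lemma map_mul_le (h : IsRadialProfile ψ) {t c : ℝ} (ht : 0 ≤ t) (hc : 0 ≤ c) (hc1 : c ≤ 1) :
    ψ (c * t) ≤ c * ψ t := by
  have := h.convexOn.2 (x := t) ht (y := 0) Set.self_mem_Ici hc (sub_nonneg.2 hc1) (by ring)
  simpa [h.map_zero] using this

/-- Convexity and `ψ 0 = 0` make `ψ t / t` nondecreasing, which settles `t ≥ 1`; for `t ≤ 1` the
left side is not positive. This is the source of all exponential tail bounds for positions. -/
lemma linear_le (h : IsRadialProfile ψ) {t : ℝ} (ht : 0 ≤ t) : ψ 1 * t - ψ 1 ≤ ψ t := by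
  have h1 := h.pos one_pos
  rcases le_total t 1 with h2 | h2
  · have := h.nonneg ht
    nlinarith
  · have h3 : 0 < t := by linarith
    have := h.map_mul_le ht (inv_nonneg.2 ht) (inv_le_one_of_one_le₀ h2)
    rw [inv_mul_cancel₀ h3.ne', inv_mul_eq_div, le_div_iff₀ h3] at this
    linarith

lemma scale (h : IsRadialProfile ψ) {c k : ℝ} (hc : 0 < c) (hk : 0 < k) :
    IsRadialProfile (fun t => c * ψ (k * t)) where
  continuous := by have := h.continuous; fun_prop
  strictMonoOn := fun x hx y hy hxy => by
    have hx : 0 ≤ x := hx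
    have hy : 0 ≤ y := hy
    exact mul_lt_mul_of_pos_left (h.strictMonoOn (by simp; positivity) (by simp; positivity)
      (mul_lt_mul_of_pos_left hxy hk)) hc
  convexOn := by
    refine ⟨convex_Ici 0, fun x hx y hy a b ha hb hab => ?_⟩
    have hx : 0 ≤ x := hx
    have hy : 0 ≤ y := hy
    have := h.convexOn.2 (x := k * x) (y := k * y) (by simp; positivity) (by simp; positivity)
      ha hb hab
    simp only [smul_eq_mul] at this ⊢
    rw [show k * (a * x + b * y) = a * (k * x) + b * (k * y) by ring]
    nlinarith
  map_zero := by simp [h.map_zero]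

lemma sq : IsRadialProfile (fun t => t ^ 2) where
  continuous := by fun_prop
  strictMonoOn := fun x hx y _ hxy => pow_lt_pow_left₀ hxy hx two_ne_zero
  convexOn := convexOn_pow 2
  map_zero := by simp

/-- Separating the two centres by `β` strictly improves the profile, by more than the loss in volume
caused by a slight dilation. -/
lemma exists_dilation (h : IsRadialProfile ψ) {β c : ℝ} (hβ : 0 < β) (hc : 0 ≤ c) :
    ∃ ε : ℝ, 0 < ε ∧ ε ≤ 1 / 2 ∧ ∀ r : ℝ, 0 ≤ r →
      ψ ((1 - ε) * r) + c * ε ≤ ψ (√(r ^ 2 + β ^ 2)) := by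
  -- Beyond `R` the loss `c * ε` is paid by the gain `ε * ψ r` from dilating; on `[0, R]` it is paid
  -- by the positive minimum `m` of the gap.
  obtain ⟨R, hR0, hR⟩ : ∃ R : ℝ, 0 ≤ R ∧ c ≤ ψ R := by
    have h1 := h.pos one_pos
    refine ⟨c / ψ 1 + 1, by positivity, ?_⟩
    have := h.linear_le (t := c / ψ 1 + 1) (by positivity)
    have h2 : ψ 1 * (c / ψ 1 + 1) - ψ 1 = c := by field_simp; ring
    linarith
  have hsq : ∀ r : ℝ, 0 ≤ r → r < √(r ^ 2 + β ^ 2) := fun r hr =>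
    Real.lt_sqrt_of_sq_lt (by nlinarith)
  have hcont : Continuous fun r : ℝ => ψ (√(r ^ 2 + β ^ 2)) - ψ r := by
    have := h.continuous
    fun_prop
  obtain ⟨r₀, hr₀, hmin⟩ := (isCompact_Icc (a := (0 : ℝ)) (b := R)).exists_isMinOn
    ⟨0, by simp [hR0]⟩ hcont.continuousOn
  set m := ψ (√(r₀ ^ 2 + β ^ 2)) - ψ r₀ with hm
  have hm0 : 0 < m := sub_pos.2 (h.strictMonoOn hr₀.1 (Real.sqrt_nonneg _) (hsq r₀ hr₀.1))
  refine ⟨min (1 / 2) (m / (c + 1)), by positivity, min_le_left _ _, fun r hr => ?_⟩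
  set ε := min (1 / 2) (m / (c + 1)) with hε
  have hε0 : 0 < ε := by positivity
  have hε1 : ε ≤ 1 / 2 := min_le_left _ _
  have hε2 : ε * (c + 1) ≤ m := by
    rw [← le_div_iff₀ (by positivity)]
    exact min_le_right _ _
  have hle : ψ ((1 - ε) * r) ≤ (1 - ε) * ψ r := h.map_mul_le hr (by linarith) (by linarith)
  rcases le_total r R with hrR | hrR
  · have h1 : m ≤ ψ (√(r ^ 2 + β ^ 2)) - ψ r := hmin ⟨hr, hrR⟩
    have h2 := h.nonneg hr
    nlinarith
  · have h1 := h.monotoneOn hR0 hr hrR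
    have h2 := h.strictMonoOn hr (Real.sqrt_nonneg _) (hsq r hr)
    nlinarith

end IsRadialProfile

/-! ### The profiles `ψ_s` and their comparison with `t ^ 2` -/

/-- The common shape of the functions `ψ_s`, `0 < s < ∞`. -/
noncomputable def lownerShape (u : ℝ) : ℝ :=
  √(1 + 4 * u ^ 2) - Real.log ((1 + √(1 + 4 * u ^ 2)) / 2) - 1

/-- With `w = √(1 + 4u²)` one has `w' = 4u / w`, and the logarithm turns the factor `1` into `1 -
1/(1 + w) = w/(1 + w)`, cancelling `w`. All later estimates on the shape except the linear bound
compare such derivatives. -/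
lemma hasDerivAt_lownerShape (u : ℝ) :
    HasDerivAt lownerShape (4 * u / (1 + √(1 + 4 * u ^ 2))) u := by
  have h0 : (0 : ℝ) < 1 + 4 * u ^ 2 := by positivity
  have h1 : HasDerivAt (fun u : ℝ => 1 + 4 * u ^ 2) (8 * u) u := by
    exact (((hasDerivAt_pow 2 u).const_mul 4).const_add 1).congr_deriv (by push_cast; ring)
  have h2 := h1.sqrt h0.ne'
  have hw : 0 < √(1 + 4 * u ^ 2) := Real.sqrt_pos.2 h0
  have h3 := (h2.sub (((h2.const_add 1).div_const 2).log (by positivity))).sub_const 1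
  refine h3.congr_deriv ?_
  field_simp
  ring

lemma lownerShape_zero : lownerShape 0 = 0 := by
  simp [lownerShape]

lemma continuous_lownerShape : Continuous lownerShape :=
  continuous_iff_continuousAt.2 fun u => (hasDerivAt_lownerShape u).continuousAt

lemma isRadialProfile_lownerShape : IsRadialProfile lownerShape where
  continuous := continuous_lownerShape
  map_zero := lownerShape_zero
  strictMonoOn := by
    refine strictMonoOn_of_deriv_pos (convex_Ici 0) continuous_lownerShape.continuousOn ?_
    intro u hu
    rw [interior_Ici] at hu
    have hu : 0 < u := hu
    rw [(hasDerivAt_lownerShape u).deriv]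
    positivity
  convexOn := by
    refine MonotoneOn.convexOn_of_deriv (convex_Ici 0) continuous_lownerShape.continuousOn
      (fun u _ => (hasDerivAt_lownerShape u).differentiableAt.differentiableWithinAt) ?_
    intro u hu v hv huv
    rw [interior_Ici] at hu hv
    have hu : 0 < u := hu
    have hv : 0 < v := hv
    rw [(hasDerivAt_lownerShape u).deriv, (hasDerivAt_lownerShape v).deriv,
      div_le_div_iff₀ (by positivity) (by positivity)]
    have h1 : u * √(1 + 4 * v ^ 2) ≤ v * √(1 + 4 * u ^ 2) := by
      refine le_of_sq_le_sq ?_ (by positivity)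
      rw [mul_pow, mul_pow, Real.sq_sqrt (by positivity), Real.sq_sqrt (by positivity)]
      nlinarith
    nlinarith

/-- A function vanishing at `0` with nonnegative derivative on `(0, ∞)` is nonnegative there. -/
lemma nonneg_of_hasDerivAt_nonneg {k k' : ℝ → ℝ} (h0 : k 0 = 0)
    (hk : ∀ u, HasDerivAt k (k' u) u) (hk' : ∀ u, 0 < u → 0 ≤ k' u) {u : ℝ} (hu : 0 ≤ u) :
    0 ≤ k u := by
  have : MonotoneOn k (Set.Ici 0) := by
    refine monotoneOn_of_deriv_nonneg (convex_Ici 0)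
      (fun u _ => (hk u).continuousAt.continuousWithinAt)
      (fun u _ => (hk u).differentiableAt.differentiableWithinAt) ?_
    intro u hu
    rw [interior_Ici] at hu
    rw [(hk u).deriv]
    exact hk' u hu
  have := this Set.self_mem_Ici hu hu
  rwa [h0] at this

lemma lownerShape_le_sq {u : ℝ} (hu : 0 ≤ u) : lownerShape u ≤ u ^ 2 := by
  rw [← sub_nonneg]
  refine nonneg_of_hasDerivAt_nonneg (k := fun u => u ^ 2 - lownerShape u) (by simp [lownerShape_zero])
    (fun u => (hasDerivAt_pow 2 u).sub (hasDerivAt_lownerShape u)) ?_ hu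
  intro u hu
  have h1 : 1 ≤ √(1 + 4 * u ^ 2) := Real.one_le_sqrt.2 (by nlinarith)
  rw [sub_nonneg, div_le_iff₀ (by positivity)]
  push_cast
  nlinarith

lemma sq_sub_le_lownerShape {u : ℝ} (hu : 0 ≤ u) : u ^ 2 - u ^ 4 / 2 ≤ lownerShape u := by
  rw [← sub_nonneg]
  refine nonneg_of_hasDerivAt_nonneg (k := fun u => lownerShape u - (u ^ 2 - u ^ 4 / 2))
    (by simp [lownerShape_zero]) (fun u => (hasDerivAt_lownerShape u).sub
      ((hasDerivAt_pow 2 u).sub ((hasDerivAt_pow 4 u).div_const 2))) ?_ hu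
  intro u hu
  have h1 : √(1 + 4 * u ^ 2) ≤ 1 + 2 * u ^ 2 :=
    Real.sqrt_le_iff.2 ⟨by positivity, by nlinarith [sq_nonneg (u ^ 2)]⟩
  have h2 : (2 * u - 2 * u ^ 3) * (2 + 2 * u ^ 2) ≤ 4 * u := by
    nlinarith [pow_pos hu 5]
  have h3 : 2 * u - 2 * u ^ 3 ≤ 4 * u / (1 + √(1 + 4 * u ^ 2)) := by
    refine ((le_div_iff₀ (by positivity)).2 h2).trans ?_
    exact div_le_div_of_nonneg_left (by positivity) (by positivity) (by linarith)
  rw [sub_nonneg]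
  refine le_trans (le_of_eq ?_) h3
  push_cast
  ring

/-- Both derivatives carry the factor `c²`, and the remaining denominators decrease when `u` becomes
`c * u`. Taking `c = √(s / s')` gives monotonicity of `rescaledPsi` in `s`. -/
lemma sq_mul_lownerShape_le {c u : ℝ} (hc : 0 ≤ c) (hc1 : c ≤ 1) (hu : 0 ≤ u) :
    c ^ 2 * lownerShape u ≤ lownerShape (c * u) := by
  rw [← sub_nonneg]
  refine nonneg_of_hasDerivAt_nonneg (k := fun u => lownerShape (c * u) - c ^ 2 * lownerShape u)
    (by simp [lownerShape_zero]) (fun u => ((hasDerivAt_lownerShape (c * u)).comp u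
      ((hasDerivAt_id u).const_mul c)).sub ((hasDerivAt_lownerShape u).const_mul (c ^ 2))) ?_ hu
  intro u hu
  have h1 : √(1 + 4 * (c * u) ^ 2) ≤ √(1 + 4 * u ^ 2) := by
    gcongr
    nlinarith
  have h2 : 4 * u / (1 + √(1 + 4 * u ^ 2)) ≤ 4 * u / (1 + √(1 + 4 * (c * u) ^ 2)) := by
    gcongr
  have h3 : 4 * (c * u) / (1 + √(1 + 4 * (c * u) ^ 2)) * (c * 1)
      = c ^ 2 * (4 * u / (1 + √(1 + 4 * (c * u) ^ 2))) := by ring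
  rw [h3, ← mul_sub]
  exact mul_nonneg (sq_nonneg c) (sub_nonneg.2 h2)

lemma lownerShape_le_two_mul {u : ℝ} (hu : 0 ≤ u) : lownerShape u ≤ 2 * u := by
  have h1 : √(1 + 4 * u ^ 2) ≤ 1 + 2 * u :=
    Real.sqrt_le_iff.2 ⟨by positivity, by nlinarith⟩
  have h2 : 1 ≤ √(1 + 4 * u ^ 2) := Real.one_le_sqrt.2 (by nlinarith)
  have h3 := Real.log_nonneg (x := (1 + √(1 + 4 * u ^ 2)) / 2) (by linarith)
  unfold lownerShape
  linarith

/-- The function `ψ_s` rescaled so that it increases to `t ↦ t ^ 2` as `s → ∞`. -/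
noncomputable def rescaledPsi (s t : ℝ) : ℝ := s / 2 * lownerShape (√(2 / s) * t)

lemma isRadialProfile_rescaledPsi {s : ℝ} (hs : 0 < s) : IsRadialProfile (rescaledPsi s) :=
  isRadialProfile_lownerShape.scale (by positivity) (by positivity)

lemma rescaledPsi_le_sq {s t : ℝ} (hs : 0 < s) (ht : 0 ≤ t) : rescaledPsi s t ≤ t ^ 2 := by
  have h := lownerShape_le_sq (u := √(2 / s) * t) (by positivity)
  rw [mul_pow, Real.sq_sqrt (by positivity)] at h
  calc rescaledPsi s t ≤ s / 2 * (2 / s * t ^ 2) := by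
        unfold rescaledPsi; gcongr
    _ = t ^ 2 := by field_simp

lemma sq_sub_le_rescaledPsi {s t : ℝ} (hs : 0 < s) (ht : 0 ≤ t) :
    t ^ 2 - t ^ 4 / s ≤ rescaledPsi s t := by
  have h := sq_sub_le_lownerShape (u := √(2 / s) * t) (by positivity)
  rw [mul_pow, mul_pow, show √(2 / s) ^ 4 = (√(2 / s) ^ 2) ^ 2 by ring,
    Real.sq_sqrt (by positivity)] at h
  calc t ^ 2 - t ^ 4 / s = s / 2 * (2 / s * t ^ 2 - (2 / s) ^ 2 * t ^ 4 / 2) := by field_simp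
    _ ≤ rescaledPsi s t := by unfold rescaledPsi; gcongr

lemma rescaledPsi_mono {s s' t : ℝ} (hs : 0 < s) (hss' : s ≤ s') (ht : 0 ≤ t) :
    rescaledPsi s t ≤ rescaledPsi s' t := by
  have hs' : 0 < s' := hs.trans_le hss'
  have h := sq_mul_lownerShape_le (c := √(s / s')) (u := √(2 / s) * t) (by positivity)
    (Real.sqrt_le_one.2 (div_le_one_of_le₀ hss' hs'.le)) (by positivity)
  rw [← mul_assoc, ← Real.sqrt_mul (by positivity), Real.sq_sqrt (by positivity),
    show s / s' * (2 / s) = 2 / s' by field_simp] at h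
  calc rescaledPsi s t = s' / 2 * (s / s' * lownerShape (√(2 / s) * t)) := by
        unfold rescaledPsi; field_simp
    _ ≤ rescaledPsi s' t := by unfold rescaledPsi; gcongr

lemma rescaledPsi_le_mul {s t : ℝ} (hs : 0 < s) (ht : 0 ≤ t) :
    rescaledPsi s t ≤ s * √(2 / s) * t := by
  have h := lownerShape_le_two_mul (u := √(2 / s) * t) (by positivity)
  calc rescaledPsi s t ≤ s / 2 * (2 * (√(2 / s) * t)) := by unfold rescaledPsi; gcongr
    _ = _ := by ring

lemma lownerPsi_top : lownerPsi ∞ = fun t => t ^ 2 := by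
  ext t
  simp [lownerPsi]

lemma lownerPsi_coe {s : ℝ≥0} (hs : 0 < s) :
    lownerPsi s = fun t => rescaledPsi s ((s * √(2 / s))⁻¹ * t) := by
  have hs' : (0 : ℝ) < s := hs
  ext t
  have : √(2 / (s : ℝ)) * ((s * √(2 / s))⁻¹ * t) = t / s := by
    have : 0 < √(2 / (s : ℝ)) := by positivity
    field_simp
  simp only [rescaledPsi, this]
  simp [lownerPsi, lownerShape, hs.ne']

lemma positionClass_comp_mul {d : ℕ} (ψ : ℝ → ℝ) {c : ℝ} (hc : 0 < c) :
    positionClass d (fun t => ψ (c * t)) = positionClass d ψ := by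
  have key : ∀ (ψ : ℝ → ℝ) {c : ℝ}, 0 < c →
      positionClass d (fun t => ψ (c * t)) ⊆ positionClass d ψ := by
    rintro ψ c hc _ ⟨A, α, a, hα, rfl⟩
    refine ⟨A.trans (ContinuousLinearEquiv.smulLeft (Units.mk0 c hc.ne')), α, a, hα, ?_⟩
    ext x
    simp [norm_smul, abs_of_pos hc, Units.smul_def]
  refine (key ψ hc).antisymm ?_
  have := key (fun t => ψ (c * t)) (inv_pos.2 hc)
  simpa [mul_inv_cancel_left₀ hc.ne'] using this

lemma positionClass_lownerPsi {d : ℕ} {s : ℝ≥0} (hs : 0 < s) :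
    positionClass d (lownerPsi s) = positionClass d (rescaledPsi s) := by
  have hs' : (0 : ℝ) < s := hs
  rw [lownerPsi_coe hs, positionClass_comp_mul _ (by positivity)]

/-! ### Polar decomposition, determinants and compact sets of linear maps -/

section LinearAlgebra

variable {E : Type*} [NormedAddCommGroup E] [InnerProductSpace ℝ E]

/-- The linear map which is diagonal in a given orthonormal basis. -/
noncomputable def OrthonormalBasis.diagonalMap {ι : Type*} [Fintype ι] [DecidableEq ι]
    (b : OrthonormalBasis ι ℝ E) (c : ι → ℝ) : E →ₗ[ℝ] E :=
  Matrix.toLin b.toBasis b.toBasis (Matrix.diagonal c)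

namespace OrthonormalBasis

variable {ι : Type*} [Fintype ι] [DecidableEq ι] (b : OrthonormalBasis ι ℝ E)

lemma repr_diagonalMap (c : ι → ℝ) (y : E) (i : ι) :
    b.repr (b.diagonalMap c y) i = c i * b.repr y i := by
  have := congrFun (Matrix.repr_toLin b.toBasis b.toBasis (Matrix.diagonal c) y) i
  simpa [Matrix.mulVec_diagonal, diagonalMap] using this

lemma det_diagonalMap (c : ι → ℝ) : LinearMap.det (b.diagonalMap c) = ∏ i, c i := by
  rw [diagonalMap, LinearMap.det_toLin, Matrix.det_diagonal]

lemma diagonalMap_eq_self {c : ι → ℝ} (hc : ∀ i, c i = 1) (y : E) : b.diagonalMap c y = y := by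
  apply b.repr.injective
  ext i
  rw [repr_diagonalMap, hc, one_mul]

lemma diagonalMap_average (c : ι → ℝ) (y : E) :
    b.diagonalMap (fun i => (1 + c i) / 2) y = (1 / 2 : ℝ) • (y + b.diagonalMap c y) := by
  apply b.repr.injective
  ext i
  simp only [repr_diagonalMap, map_smul, map_add, PiLp.smul_apply, PiLp.add_apply, smul_eq_mul]
  ring

end OrthonormalBasis

variable [FiniteDimensional ℝ E]

/-- The positive part of the polar decomposition, diagonalized. -/
lemma exists_norm_eq_norm_diagonalMap (B : E →L[ℝ] E) (hB : B.det ≠ 0) :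
    ∃ (b : OrthonormalBasis (Fin (Module.finrank ℝ E)) ℝ E) (c : Fin (Module.finrank ℝ E) → ℝ),
      (∀ i, 0 < c i) ∧ (∀ y, ‖B y‖ = ‖b.diagonalMap c y‖) ∧ |B.det| = ∏ i, c i := by
  set T : E →ₗ[ℝ] E := B.toLinearMap with hT
  have hS := T.isSymmetric_adjoint_comp_self
  have hpos := T.isPositive_adjoint_comp_self.nonneg_eigenvalues rfl
  set μ := hS.eigenvalues rfl with hμ
  set b := hS.eigenvectorBasis rfl with hb
  have hdet : B.det ^ 2 = ∏ i, μ i := by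
    have h1 := hS.det_eq_prod_eigenvalues rfl
    have h2 := T.normDet_sq
    rw [LinearMap.normDet_eq_abs_det] at h2
    rw [← hμ] at h1
    simp only [RCLike.ofReal_real_eq_id, id_eq] at h1 h2
    rw [← h1, ← h2, sq_abs]
  have hμ0 : ∀ i, 0 < μ i := fun i => (hpos i).lt_of_ne fun h => by
    have : ∏ i, μ i = 0 := Finset.prod_eq_zero (Finset.mem_univ i) h.symm
    rw [this] at hdet
    exact hB (pow_eq_zero_iff two_ne_zero |>.1 hdet)
  refine ⟨b, fun i => √(μ i), fun i => Real.sqrt_pos.2 (hμ0 i), fun y => ?_, ?_⟩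
  · have h1 : ‖B y‖ ^ 2 = ∑ i, μ i * (b.repr y i) ^ 2 := by
      have : ‖B y‖ ^ 2 = inner ℝ ((T.adjoint ∘ₗ T) y) y := by
        rw [LinearMap.comp_apply, LinearMap.adjoint_inner_left, real_inner_self_eq_norm_sq]
        rfl
      rw [this, ← b.repr.inner_map_map, PiLp.inner_apply]
      refine Finset.sum_congr rfl fun i _ => ?_
      have := hS.eigenvectorBasis_apply_self_apply rfl y i
      rw [← hb, ← hμ] at this
      rw [this]
      simp
      ring
    have h2 : ‖b.diagonalMap (fun i => √(μ i)) y‖ ^ 2 = ∑ i, μ i * (b.repr y i) ^ 2 := by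
      rw [← b.repr.norm_map, EuclideanSpace.norm_sq_eq]
      refine Finset.sum_congr rfl fun i _ => ?_
      rw [b.repr_diagonalMap, Real.norm_eq_abs, sq_abs, mul_pow, Real.sq_sqrt (hpos i)]
    exact (sq_eq_sq₀ (norm_nonneg _) (norm_nonneg _)).1 (h1.trans h2.symm)
  · rw [← Real.sqrt_sq_eq_abs, hdet, Real.sqrt_prod]
    exact fun i _ => hpos i

lemma ContinuousLinearMap.exists_equiv_of_det_ne_zero {A : E →L[ℝ] E} (hA : A.det ≠ 0) :
    ∃ e : E ≃L[ℝ] E, (e : E →L[ℝ] E) = A :=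
  ⟨A.toContinuousLinearEquivOfDetNeZero hA, by ext; simp⟩

/-- The map `B A⁻¹` preserves norms, so its determinant has absolute value `1`. -/
lemma abs_det_eq_of_norm_eq {A B : E →L[ℝ] E} (hA : A.det ≠ 0) (h : ∀ v, ‖A v‖ = ‖B v‖) :
    |A.det| = |B.det| := by
  obtain ⟨e, rfl⟩ := ContinuousLinearMap.exists_equiv_of_det_ne_zero hA
  set C : E →L[ℝ] E := B.comp (e.symm : E →L[ℝ] E) with hC
  have hB : B = C.comp (e : E →L[ℝ] E) := by ext; simp [C]
  have hdet : B.det = C.det * (e : E →L[ℝ] E).det := by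
    rw [hB]
    exact LinearMap.det_comp _ _
  have h1 := LinearIsometry.normDet_eq_one
    (⟨C.toLinearMap, fun v => by simpa [C] using (h (e.symm v)).symm⟩ : E →ₗᵢ[ℝ] E)
  simp only at h1
  rw [LinearMap.normDet_eq_abs_det] at h1
  have h2 : |C.det| = 1 := h1
  rw [hdet, abs_mul, h2, one_mul]

/-- Strict log-concavity of the determinant, in the form of an interpolation between two affine
maps: unless the linear parts agree up to an isometry, some affine map whose norm is at most the
average of the two norms has a determinant strictly larger than the geometric mean. -/
lemma norm_eq_or_exists_interpolation {A₁ A₂ : E →L[ℝ] E} (h₁ : A₁.det ≠ 0) (h₂ : A₂.det ≠ 0)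
    (a₁ a₂ : E) : (∀ v, ‖A₁ v‖ = ‖A₂ v‖) ∨
      ∃ (A : E →L[ℝ] E) (a : E), A.det ≠ 0 ∧
        (∀ x, ‖A (x - a)‖ ≤ (‖A₁ (x - a₁)‖ + ‖A₂ (x - a₂)‖) / 2) ∧
        |A₁.det| * |A₂.det| < A.det ^ 2 := by
  obtain ⟨e₁, rfl⟩ := ContinuousLinearMap.exists_equiv_of_det_ne_zero h₁
  -- This normalizes `A₁` to the identity. Only norms matter, so `B` can be replaced by its positive
  -- part `S`; the interpolating map is `(1 + S) / 2` composed with `A₁`.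
  set B : E →L[ℝ] E := A₂.comp (e₁.symm : E →L[ℝ] E) with hBdef
  have hA₂ : A₂ = B.comp (e₁ : E →L[ℝ] E) := by ext; simp [B]
  have hdetmul : A₂.det = B.det * (e₁ : E →L[ℝ] E).det := by
    rw [hA₂]
    exact LinearMap.det_comp _ _
  have hB : B.det ≠ 0 := fun h => h₂ (by rw [hdetmul, h, zero_mul])
  obtain ⟨b, c, hc, hnorm, hdet⟩ := exists_norm_eq_norm_diagonalMap B hB
  by_cases hc1 : ∀ i, c i = 1
  · left
    intro v
    rw [hA₂, ContinuousLinearMap.comp_apply, hnorm, b.diagonalMap_eq_self hc1]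
  right
  push Not at hc1
  obtain ⟨j, hj⟩ := hc1
  set S := b.diagonalMap c with hS
  set T : E →L[ℝ] E := (b.diagonalMap fun i => (1 + c i) / 2).toContinuousLinearMap with hT
  have hTdet : T.det = ∏ i, (1 + c i) / 2 := b.det_diagonalMap _
  have hTpos : 0 < T.det := by
    rw [hTdet]
    exact Finset.prod_pos fun i _ => by have := hc i; positivity
  have hTS : ∀ y, T y = (1 / 2 : ℝ) • (y + S y) := b.diagonalMap_average c
  obtain ⟨e, he⟩ := ContinuousLinearMap.exists_equiv_of_det_ne_zero hTpos.ne'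
  -- The centre is shifted by the vector that makes the new affine map exactly the average of `A₁ (x
  -- - a₁)` and `S (A₁ (x - a₂))`.
  set w : E := (1 / 2 : ℝ) • S (e₁ (a₂ - a₁)) with hw
  have hAdet : (T.comp (e₁ : E →L[ℝ] E)).det = T.det * (e₁ : E →L[ℝ] E).det :=
    LinearMap.det_comp _ _
  refine ⟨T.comp (e₁ : E →L[ℝ] E), a₁ + e₁.symm (e.symm w), ?_, fun x => ?_, ?_⟩
  · rw [hAdet]
    exact mul_ne_zero hTpos.ne' h₁
  · have h3 : (T.comp (e₁ : E →L[ℝ] E)) (x - (a₁ + e₁.symm (e.symm w)))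
        = (1 / 2 : ℝ) • (e₁ (x - a₁) + S (e₁ (x - a₂))) := by
      have h4 : T (e.symm w) = w := by rw [← he]; simp
      have h5 : e₁ (x - a₂) = e₁ (x - a₁) - e₁ (a₂ - a₁) := by rw [← map_sub]; congr 1; abel
      rw [ContinuousLinearMap.comp_apply, ← sub_sub, map_sub, map_sub]
      simp only [ContinuousLinearEquiv.coe_coe, ContinuousLinearEquiv.apply_symm_apply, h4]
      rw [hTS, hw, h5, map_sub S, ← smul_sub]
      congr 1
      abel
    rw [h3, norm_smul, hA₂, ContinuousLinearMap.comp_apply, hnorm]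
    have := norm_add_le (e₁ (x - a₁)) (S (e₁ (x - a₂)))
    rw [Real.norm_of_nonneg (by norm_num)]
    simp only [ContinuousLinearEquiv.coe_coe]
    linarith
  -- AM-GM for `1` and each eigenvalue `c i`, strict at the index `j` where `c j ≠ 1`.
  · have h3 : ∏ i, c i < ∏ i, ((1 + c i) / 2) ^ 2 := by
      refine Finset.prod_lt_prod (fun i _ => hc i) (fun i _ => ?_) ⟨j, Finset.mem_univ j, ?_⟩
      · nlinarith [sq_nonneg (c i - 1)]
      · have := sq_pos_of_ne_zero (sub_ne_zero.2 hj)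
        nlinarith
    rw [hAdet, hdetmul, abs_mul, hdet, mul_pow, hTdet, ← Finset.prod_pow]
    have h4 : 0 < |(e₁ : E →L[ℝ] E).det| := abs_pos.2 h₁
    rw [← sq_abs (ContinuousLinearMap.det (e₁ : E →L[ℝ] E))]
    nlinarith [mul_lt_mul_of_pos_right h3 (pow_pos h4 2)]

/-- A compact set of invertible linear maps is uniformly bounded below. -/
lemma IsCompact.exists_forall_mul_norm_le {S : Set (E →L[ℝ] E)} (hS : IsCompact S)
    (hdet : ∀ A ∈ S, A.det ≠ 0) : ∃ c : ℝ, 0 < c ∧ ∀ A ∈ S, ∀ v, c * ‖v‖ ≤ ‖A v‖ := by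
  obtain ⟨c, hc, hcle⟩ := (hS.prod (isCompact_sphere (0 : E) 1)).exists_forall_le'
    (f := fun p => ‖p.1 p.2‖) (a := 0) (by fun_prop) (by
      rintro ⟨A, v⟩ ⟨hA, hv⟩
      obtain ⟨e, rfl⟩ := ContinuousLinearMap.exists_equiv_of_det_ne_zero (hdet A hA)
      have hv0 : v ≠ 0 := by
        rintro rfl
        simp at hv
      simpa using hv0)
  refine ⟨c, hc, fun A hA v => ?_⟩
  by_cases hv : v = 0
  · simp [hv]
  have hv0 : 0 < ‖v‖ := norm_pos_iff.2 hv
  have := hcle (A, ‖v‖⁻¹ • v) ⟨hA, by simp [norm_smul, hv0.ne']⟩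
  simp only [map_smul, norm_smul, norm_inv, norm_norm] at this
  rwa [inv_mul_eq_div, le_div_iff₀ hv0] at this

lemma isCompact_setOf_norm_le_of_le_abs_det (K δ : ℝ) :
    IsCompact {A : E →L[ℝ] E | ‖A‖ ≤ K ∧ δ ≤ |A.det|} := by
  refine (isCompact_closedBall (0 : E →L[ℝ] E) K).of_isClosed_subset ?_ ?_
  · exact (isClosed_le continuous_norm continuous_const).inter
      (isClosed_le continuous_const ContinuousLinearMap.continuous_det.abs)
  · intro A hA
    simpa using hA.1

/-- The determinant is bounded on the compact unit ball and homogeneous of degree the dimension. -/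
lemma exists_abs_det_le : ∃ D : ℝ, 0 < D ∧
    ∀ (A : E →L[ℝ] E) (R : ℝ), 0 < R → ‖A‖ ≤ R → |A.det| ≤ D * R ^ Module.finrank ℝ E := by
  obtain ⟨D, hD⟩ := (isCompact_closedBall (0 : E →L[ℝ] E) 1).exists_bound_of_continuousOn
    ContinuousLinearMap.continuous_det.continuousOn
  refine ⟨max D 1, by positivity, fun A R hR hA => ?_⟩
  have h1 := hD (R⁻¹ • A) (by
    rw [mem_closedBall_zero_iff, norm_smul, norm_inv, Real.norm_of_nonneg hR.le, inv_mul_eq_div]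
    exact div_le_one_of_le₀ hA hR.le)
  have h2 : (R⁻¹ • A).det = R⁻¹ ^ Module.finrank ℝ E * A.det := LinearMap.det_smul _ _
  rw [h2, norm_mul, norm_pow, norm_inv, Real.norm_of_nonneg hR.le, inv_pow, inv_mul_eq_div,
    div_le_iff₀ (by positivity), Real.norm_eq_abs] at h1
  refine h1.trans ?_
  gcongr
  exact le_max_left _ _

end LinearAlgebra

-- Positions, their parameters and their integrals

local notation "𝔼" d => EuclideanSpace ℝ (Fin d)

/-- The position `x ↦ α e^{-ψ(|A(x - a)|)}` with parameters `p = (α, A, a)`. -/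
noncomputable def positionFun {d : ℕ} (ψ : ℝ → ℝ) (p : ℝ × ((𝔼 d) →L[ℝ] (𝔼 d)) × (𝔼 d))
    (x : 𝔼 d) : ℝ :=
  p.1 * Real.exp (-ψ ‖p.2.1 (x - p.2.2)‖)

/-- The parameters `(α, A, a)` with `α > 0` and `A` invertible. -/
def IsPositionParam {d : ℕ} (p : ℝ × ((𝔼 d) →L[ℝ] (𝔼 d)) × (𝔼 d)) : Prop :=
  0 < p.1 ∧ p.2.1.det ≠ 0

/-- The integral of a position, relative to that of `x ↦ e^{-ψ(|x|)}`. -/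
noncomputable def relVolume {d : ℕ} (p : ℝ × ((𝔼 d) →L[ℝ] (𝔼 d)) × (𝔼 d)) : ℝ :=
  p.1 / |p.2.1.det|

/-- The integral of `x ↦ e^{-ψ(|x|)}`. -/
noncomputable def profileMass (d : ℕ) (ψ : ℝ → ℝ) : ℝ≥0∞ :=
  ∫⁻ x : 𝔼 d, ENNReal.ofReal (Real.exp (-ψ ‖x‖))

variable {d : ℕ} {ψ : ℝ → ℝ} {f : (𝔼 d) → ℝ}

lemma mem_positionClass_iff {l : (𝔼 d) → ℝ} :
    l ∈ positionClass d ψ ↔ ∃ p, IsPositionParam p ∧ l = positionFun ψ p := by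
  constructor
  · rintro ⟨A, α, a, hα, rfl⟩
    exact ⟨(α, A, a), ⟨hα, (LinearEquiv.isUnit_det' A.toLinearEquiv).ne_zero⟩, rfl⟩
  · rintro ⟨⟨α, A, a⟩, ⟨hα, hA⟩, rfl⟩
    obtain ⟨e, rfl⟩ := ContinuousLinearMap.exists_equiv_of_det_ne_zero hA
    exact ⟨e, α, a, hα, rfl⟩

lemma continuous_positionFun (hψ : Continuous ψ)
    (p : ℝ × ((𝔼 d) →L[ℝ] (𝔼 d)) × (𝔼 d)) : Continuous (positionFun ψ p) := by
  unfold positionFun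
  fun_prop

lemma lintegral_positionFun (hψ : Continuous ψ) {p : ℝ × ((𝔼 d) →L[ℝ] (𝔼 d)) × (𝔼 d)}
    (hp : IsPositionParam p) :
    ∫⁻ x, ENNReal.ofReal (positionFun ψ p x)
      = ENNReal.ofReal (relVolume p) * profileMass d ψ := by
  obtain ⟨α, A, a⟩ := p
  obtain ⟨hα, hA⟩ := hp
  simp only at hα hA
  have hg : Measurable fun x : 𝔼 d => ENNReal.ofReal (Real.exp (-ψ ‖x‖)) :=
    ENNReal.measurable_ofReal.comp (by fun_prop)
  have h1 : ∫⁻ x, ENNReal.ofReal (positionFun ψ (α, A, a) x)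
      = ENNReal.ofReal α * ∫⁻ x, ENNReal.ofReal (Real.exp (-ψ ‖A (x - a)‖)) := by
    rw [← lintegral_const_mul' _ _ ENNReal.ofReal_ne_top]
    simp_rw [positionFun, ENNReal.ofReal_mul hα.le]
  rw [h1, lintegral_sub_right_eq_self (fun x => ENNReal.ofReal (Real.exp (-ψ ‖A x‖))) a,
    ← lintegral_map (μ := volume) (f := fun x : 𝔼 d => ENNReal.ofReal (Real.exp (-ψ ‖x‖))) hg
      A.continuous.measurable]
  have h2 := Measure.map_linearMap_addHaar_eq_smul_addHaar (volume : Measure (𝔼 d))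
    (f := A.toLinearMap) hA
  have h3 : Measure.map A (volume : Measure (𝔼 d)) = Measure.map A.toLinearMap volume := rfl
  rw [h3, h2, lintegral_smul_measure, relVolume, profileMass, div_eq_mul_inv,
    ENNReal.ofReal_mul hα.le, mul_assoc, smul_eq_mul, abs_inv]

lemma relVolume_pos {p : ℝ × ((𝔼 d) →L[ℝ] (𝔼 d)) × (𝔼 d)} (hp : IsPositionParam p) :
    0 < relVolume p := div_pos hp.1 (abs_pos.2 hp.2)

lemma profileMass_ne_zero (hψ : Continuous ψ) : profileMass d ψ ≠ 0 := by
  have hg : Measurable fun x : 𝔼 d => ENNReal.ofReal (Real.exp (-ψ ‖x‖)) :=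
    ENNReal.measurable_ofReal.comp (by fun_prop)
  rw [profileMass, Ne, lintegral_eq_zero_iff hg]
  intro h
  have h2 : ∀ᵐ x : 𝔼 d, False := by
    filter_upwards [h] with x hx
    have : Real.exp (-ψ ‖x‖) ≤ 0 := by simpa using hx
    exact (Real.exp_pos _).not_ge this
  simp [NeZero.ne] at h2

lemma profileMass_ne_top (hψ : IsRadialProfile ψ) : profileMass d ψ ≠ ∞ := by
  set k := ψ 1 with hk
  have hk0 : 0 < k := hψ.pos one_pos
  set n := d + 1 with hn
  have hint : Integrable fun x : 𝔼 d => (1 + ‖x‖) ^ (-(n : ℝ)) :=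
    integrable_one_add_norm (by rw [finrank_euclideanSpace_fin, hn]; push_cast; linarith)
  -- The bound `e^y ≥ y ^ n / n!` with `y = k (1 + ‖x‖)` and `n = d + 1` dominates the exponential
  -- by an integrable power.
  have hint2 := hint.const_mul (Real.exp (2 * k) * (n.factorial / k ^ n))
  have : Integrable fun x : 𝔼 d => Real.exp (-ψ ‖x‖) := by
    have hψc := hψ.continuous
    refine hint2.mono' (by fun_prop) (ae_of_all _ fun x => ?_)
    have h0 : 0 < 1 + ‖x‖ := by positivity
    have h1 := hψ.linear_le (norm_nonneg x)
    have h2 := Real.pow_div_factorial_le_exp (k * (1 + ‖x‖)) (by positivity) n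
    rw [Real.norm_of_nonneg (Real.exp_pos _).le, Real.rpow_neg h0.le, Real.rpow_natCast]
    have h3 : Real.exp (-ψ ‖x‖) ≤ Real.exp (2 * k) * (Real.exp (k * (1 + ‖x‖)))⁻¹ := by
      rw [← Real.exp_neg, ← Real.exp_add]
      exact Real.exp_le_exp.2 (by linarith)
    refine h3.trans ?_
    rw [mul_assoc]
    gcongr
    calc (Real.exp (k * (1 + ‖x‖)))⁻¹ ≤ ((k * (1 + ‖x‖)) ^ n / n.factorial)⁻¹ := by gcongr
      _ = n.factorial / k ^ n * ((1 + ‖x‖) ^ n)⁻¹ := by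
        rw [mul_pow]; field_simp
  have h := this.lintegral_lt_top
  exact h.ne

lemma lintegral_positionFun_le_iff (hψ : IsRadialProfile ψ)
    {p q : ℝ × ((𝔼 d) →L[ℝ] (𝔼 d)) × (𝔼 d)} (hp : IsPositionParam p) (hq : IsPositionParam q) :
    ∫⁻ x, ENNReal.ofReal (positionFun ψ p x) ≤ ∫⁻ x, ENNReal.ofReal (positionFun ψ q x)
      ↔ relVolume p ≤ relVolume q := by
  rw [lintegral_positionFun hψ.continuous hp, lintegral_positionFun hψ.continuous hq,
    ENNReal.mul_le_mul_iff_left (profileMass_ne_zero hψ.continuous) (profileMass_ne_top hψ),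
    ENNReal.ofReal_le_ofReal_iff (relVolume_pos hq).le]

/-- `p` solves the minimization problem for the profile `ψ`, in terms of parameters. -/
structure IsOptimalParam (ψ : ℝ → ℝ) (f : (𝔼 d) → ℝ)
    (p : ℝ × ((𝔼 d) →L[ℝ] (𝔼 d)) × (𝔼 d)) : Prop where
  isPositionParam : IsPositionParam p
  le : f ≤ positionFun ψ p
  minimal : ∀ q, IsPositionParam q → f ≤ positionFun ψ q → relVolume p ≤ relVolume q

lemma isLownerSolution_iff {s : ℝ≥0∞} (h : positionClass d (lownerPsi s) = positionClass d ψ)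
    (hψ : IsRadialProfile ψ) {l : (𝔼 d) → ℝ} :
    IsLownerSolution s f l ↔ ∃ p, IsOptimalParam ψ f p ∧ l = positionFun ψ p := by
  constructor
  · rintro ⟨hl, hle, hmin⟩
    rw [h] at hl hmin
    obtain ⟨p, hp, rfl⟩ := mem_positionClass_iff.1 hl
    exact ⟨p, ⟨hp, hle, fun q hq hfq => (lintegral_positionFun_le_iff hψ hp hq).1
      (hmin _ (mem_positionClass_iff.2 ⟨q, hq, rfl⟩) hfq)⟩, rfl⟩
  · rintro ⟨p, ⟨hp, hle, hmin⟩, rfl⟩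
    refine ⟨h ▸ mem_positionClass_iff.2 ⟨p, hp, rfl⟩, hle, fun l' hl' hfl' => ?_⟩
    rw [h] at hl'
    obtain ⟨q, hq, rfl⟩ := mem_positionClass_iff.1 hl'
    exact (lintegral_positionFun_le_iff hψ hp hq).2 (hmin q hq hfl')

/-! ### Uniqueness of the minimizer -/

section Uniqueness

/-- Two positions with the same height and linear part but different centres have a common upper
bound on their minimum with a strictly smaller integral. -/
lemma exists_relVolume_lt_of_ne_center (hψ : IsRadialProfile ψ) {α : ℝ}
    {A A' : (𝔼 d) →L[ℝ] (𝔼 d)} {a a' : 𝔼 d} (hp : IsPositionParam (α, A, a))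
    (hAA' : ∀ v, ‖A v‖ = ‖A' v‖) (haa' : a ≠ a')
    (h : f ≤ positionFun ψ (α, A, a)) (h' : f ≤ positionFun ψ (α, A', a')) :
    ∃ q, IsPositionParam q ∧ f ≤ positionFun ψ q ∧ relVolume q < relVolume (α, A, a) := by
  obtain ⟨hα, hA⟩ := hp
  simp only at hα hA
  set β : ℝ := ‖A ((1 / 2 : ℝ) • (a - a'))‖ with hβdef
  have hβ : 0 < β := by
    obtain ⟨e, rfl⟩ := ContinuousLinearMap.exists_equiv_of_det_ne_zero hA
    simpa [β, sub_eq_zero] using haa'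
  -- Dilating by `1 - ε` multiplies the volume by `(1 - ε)^(-d) ≤ e^(2dε)`; lowering the height by
  -- `e^(-cε)` wins strictly thanks to the extra `1`.
  set c : ℝ := 2 * d + 1 with hc
  obtain ⟨ε, hε0, hε1, hε⟩ := hψ.exists_dilation (c := c) hβ (by positivity)
  have h1ε : 0 < 1 - ε := by linarith
  have hdet : ((1 - ε) • A).det = (1 - ε) ^ d * A.det := by
    have := LinearMap.det_smul (1 - ε) A.toLinearMap
    rwa [finrank_euclideanSpace_fin] at this
  refine ⟨(α * Real.exp (-(c * ε)), (1 - ε) • A, (1 / 2 : ℝ) • (a + a')),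
    ⟨by positivity, ?_⟩, fun x => ?_, ?_⟩
  · rw [hdet]
    positivity
  · set u := A (x - (1 / 2 : ℝ) • (a + a')) with hu
    set w := A ((1 / 2 : ℝ) • (a - a')) with hw
    have e1 : A (x - a) = u - w := by
      rw [hu, hw, ← map_sub]; congr 1; module
    have e2 : A (x - a') = u + w := by
      rw [hu, hw, ← map_add]; congr 1; module
    have hpar := parallelogram_law_with_norm ℝ u w
    -- By the parallelogram law, the larger of `‖u - w‖²` and `‖u + w‖²` is at least their mean
    -- `‖u‖² + ‖w‖²`.
    have key : √(‖u‖ ^ 2 + β ^ 2) ≤ max ‖A (x - a)‖ ‖A (x - a')‖ := by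
      rw [e1, e2]
      rcases le_total ‖u - w‖ ‖u + w‖ with hle | hle
      · rw [max_eq_right hle]
        refine Real.sqrt_le_iff.2 ⟨norm_nonneg _, ?_⟩
        nlinarith [norm_nonneg (u - w)]
      · rw [max_eq_left hle]
        refine Real.sqrt_le_iff.2 ⟨norm_nonneg _, ?_⟩
        nlinarith [norm_nonneg (u + w)]
    have hfx : f x ≤ α * Real.exp (-ψ (max ‖A (x - a)‖ ‖A (x - a')‖)) := by
      rcases max_choice ‖A (x - a)‖ ‖A (x - a')‖ with hm | hm
      · rw [hm]; exact h x
      · rw [hm, hAA']; exact h' x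
    refine hfx.trans ?_
    simp only [positionFun]
    rw [mul_assoc, ← Real.exp_add, _root_.smul_apply, norm_smul,
      Real.norm_of_nonneg h1ε.le]
    have h1 := hε ‖u‖ (norm_nonneg u)
    have h2 := hψ.monotoneOn (Real.sqrt_nonneg _) ((norm_nonneg _).trans (le_max_left _ _)) key
    gcongr
    linarith
  · have h1 : Real.exp (-(c * ε)) < (1 - ε) ^ d := by
      have h2 : Real.exp (-(2 * ε)) ≤ 1 - ε := by
        have h3 := Real.add_one_le_exp (2 * ε)
        rw [Real.exp_neg]
        refine inv_le_of_inv_le₀ h1ε (le_trans ?_ h3)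
        rw [inv_eq_one_div, div_le_iff₀ h1ε]
        nlinarith
      calc Real.exp (-(c * ε)) < Real.exp (d * (-(2 * ε))) := by
            apply Real.exp_lt_exp.2
            rw [hc]; nlinarith
        _ = Real.exp (-(2 * ε)) ^ d := Real.exp_nat_mul _ _
        _ ≤ _ := by gcongr
    simp only [relVolume]
    rw [hdet, abs_mul, abs_of_pos (pow_pos h1ε d), div_lt_div_iff₀ (by positivity) (by positivity)]
    have : 0 < α * |A.det| := by positivity
    nlinarith

/-- The minimization problem has at most one solution. -/
lemma IsOptimalParam.positionFun_eq (hψ : IsRadialProfile ψ)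
    {p q : ℝ × ((𝔼 d) →L[ℝ] (𝔼 d)) × (𝔼 d)} (hp : IsOptimalParam ψ f p)
    (hq : IsOptimalParam ψ f q) : positionFun ψ p = positionFun ψ q := by
  obtain ⟨α, A, a⟩ := p
  obtain ⟨α', A', a'⟩ := q
  have hvol : relVolume (α, A, a) = relVolume (α', A', a') :=
    (hp.minimal _ hq.isPositionParam hq.le).antisymm (hq.minimal _ hp.isPositionParam hp.le)
  obtain ⟨hα, hA⟩ := hp.isPositionParam
  obtain ⟨hα', hA'⟩ := hq.isPositionParam
  simp only at hα hA hα' hA'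
  have hA0 : 0 < |A.det| := abs_pos.2 hA
  have hA'0 : 0 < |A'.det| := abs_pos.2 hA'
  simp only [relVolume] at hvol
  rcases norm_eq_or_exists_interpolation hA hA' a a' with hAA' | ⟨B, b, hB, hle, hlt⟩
  · have hdet : |A.det| = |A'.det| := abs_det_eq_of_norm_eq hA hAA'
    have hαα' : α = α' := by
      rw [hdet] at hvol
      exact (div_left_inj' hA'0.ne').1 hvol
    subst hαα'
    have haa' : a = a' := by
      by_contra hne
      obtain ⟨r, hr, hfr, hlt⟩ :=
        exists_relVolume_lt_of_ne_center hψ hp.isPositionParam hAA' hne hp.le hq.le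
      exact hlt.not_ge (hp.minimal r hr hfr)
    subst haa'
    ext x
    simp only [positionFun, hAA']
  · exfalso
    -- Where `f` is positive, it is at most the geometric mean of the two positions, and convexity
    -- and monotonicity of `ψ` bound this mean by the interpolated position.
    have hfle : f ≤ positionFun ψ (√(α * α'), B, b) := fun x => by
      have h1 : f x ≤ α * Real.exp (-ψ ‖A (x - a)‖) := hp.le x
      have h2 : f x ≤ α' * Real.exp (-ψ ‖A' (x - a')‖) := hq.le x
      have h3 : ψ ‖B (x - b)‖ ≤ (ψ ‖A (x - a)‖ + ψ ‖A' (x - a')‖) / 2 := by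
        have h4 := hψ.convexOn.2 (x := ‖A (x - a)‖) (norm_nonneg _) (y := ‖A' (x - a')‖)
          (norm_nonneg _) one_half_pos.le one_half_pos.le (add_halves 1)
        simp only [smul_eq_mul] at h4
        have h5 := hψ.monotoneOn (norm_nonneg _) (Set.mem_Ici.2 (by positivity)) (hle x)
        rw [show (‖A (x - a)‖ + ‖A' (x - a')‖) / 2 = 1 / 2 * ‖A (x - a)‖ + 1 / 2 * ‖A' (x - a')‖
          by ring] at h5
        linarith
      simp only [positionFun]
      rcases le_or_gt (f x) 0 with h6 | h6
      · exact h6.trans (by positivity)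
      have h7 : f x ^ 2 ≤ (α * α') * (Real.exp (-(ψ ‖A (x - a)‖ + ψ ‖A' (x - a')‖))) := by
        have := mul_le_mul h1 h2 h6.le (by positivity)
        rw [neg_add, Real.exp_add]
        nlinarith
      refine le_of_sq_le_sq (h7.trans ?_) (by positivity)
      rw [mul_pow, Real.sq_sqrt (by positivity), ← Real.exp_nat_mul]
      gcongr
      push_cast
      linarith
    have hmin := hp.minimal (√(α * α'), B, b)
      ⟨Real.sqrt_pos.2 (by positivity), hB⟩ hfle
    simp only [relVolume] at hmin
    have hsq : (α / |A.det|) ^ 2 ≤ (√(α * α') / |B.det|) ^ 2 := by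
      gcongr
    rw [div_pow (√(α * α')), Real.sq_sqrt (by positivity), sq_abs] at hsq
    have h8 : (α / |A.det|) ^ 2 = α * α' / (|A.det| * |A'.det|) := by
      rw [sq]
      nth_rewrite 2 [hvol]
      rw [div_mul_div_comm]
    rw [h8] at hsq
    exact hsq.not_gt (div_lt_div_of_pos_left (by positivity) (by positivity) hlt)

end Uniqueness

/-! ### Existence of the minimizer by compactness -/

/-- Positions of bounded relative volume which are bounded below on a fixed ball range over a
compact set of parameters. -/
lemma exists_isCompact_param (hψ : IsRadialProfile ψ) {m r : ℝ} (hm : 0 < m) (hr : 0 < r) (C : ℝ)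
    (x₀ : 𝔼 d) : ∃ S : Set (ℝ × ((𝔼 d) →L[ℝ] (𝔼 d)) × (𝔼 d)), IsCompact S ∧
      (∀ p ∈ S, IsPositionParam p) ∧ ∀ p, IsPositionParam p → relVolume p ≤ C →
        (∀ x ∈ Metric.closedBall x₀ r, m ≤ positionFun ψ p x) → p ∈ S := by
  obtain ⟨D, hD, hdetle⟩ := exists_abs_det_le (E := 𝔼 d)
  rw [finrank_euclideanSpace_fin] at hdetle
  set k := ψ 1 with hk
  have hk0 : 0 < k := hψ.pos one_pos
  set C' := max C 1 with hC'
  have hC'0 : 0 < C' := lt_max_of_lt_right one_pos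
  -- `M` bounds `L = log (α / m) + k`. On the ball `‖A (x - a)‖ ≤ L / k`, so `|det A|` is at most of
  -- order `L ^ d`, while `α = m e^(L - k) ≤ C' |det A|`; comparing with `e^L ≥ L^(d+1) / (d+1)!`
  -- gives `L ≤ M`.
  set M : ℝ := C' * D / (k * r) ^ d * Real.exp k / m * (d + 1).factorial with hM
  have hM0 : 0 < M := by positivity
  set T : Set ((𝔼 d) →L[ℝ] (𝔼 d)) := {A | ‖A‖ ≤ M / (k * r) ∧ m / C' ≤ |A.det|} with hT
  have hTc : IsCompact T := isCompact_setOf_norm_le_of_le_abs_det _ _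
  have hTdet : ∀ A ∈ T, A.det ≠ 0 := by
    rintro A ⟨-, hA⟩ h
    rw [h, abs_zero] at hA
    exact hA.not_gt (by positivity)
  obtain ⟨c, hc, hcT⟩ := hTc.exists_forall_mul_norm_le hTdet
  refine ⟨Set.Icc m (m * Real.exp M) ×ˢ T ×ˢ Metric.closedBall x₀ (M / k / c),
    isCompact_Icc.prod (hTc.prod (isCompact_closedBall _ _)),
    fun p hp => ⟨hm.trans_le hp.1.1, hTdet _ hp.2.1⟩, ?_⟩
  rintro ⟨α, A, a⟩ ⟨hα, hA⟩ hvol hlow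
  simp only at hα hA
  simp only [relVolume] at hvol
  have hA0 : 0 < |A.det| := abs_pos.2 hA
  have hle : ∀ x ∈ Metric.closedBall x₀ r, k * ‖A (x - a)‖ ≤ Real.log (α / m) + k := fun x hx => by
    have h1 : m ≤ α * Real.exp (-ψ ‖A (x - a)‖) := hlow x hx
    have h2 : Real.exp (ψ ‖A (x - a)‖) ≤ α / m := by
      rw [Real.exp_neg] at h1
      rw [le_div_iff₀ hm]
      calc _ ≤ Real.exp (ψ ‖A (x - a)‖) * (α * (Real.exp (ψ ‖A (x - a)‖))⁻¹) := by gcongr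
        _ = α := by field_simp
    have h3 := (Real.le_log_iff_exp_le (by positivity)).2 h2
    have h4 := hψ.linear_le (norm_nonneg (A (x - a)))
    linarith
  have hmα : m ≤ α := by
    refine (hlow x₀ (Metric.mem_closedBall_self hr.le)).trans ?_
    simp only [positionFun]
    have := hψ.nonneg (norm_nonneg (A (x₀ - a)))
    exact mul_le_of_le_one_right hα.le (Real.exp_le_one_iff.2 (by linarith))
  set L := Real.log (α / m) + k with hL
  have hlog : 0 ≤ Real.log (α / m) := Real.log_nonneg ((one_le_div hm).2 hmα)
  have hL0 : 0 < L := by linarith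
  have hαL : α = m * Real.exp (L - k) := by
    rw [hL, add_sub_cancel_right, Real.exp_log (by positivity)]
    field_simp
  have hAnorm : ‖A‖ ≤ L / (k * r) := by
    -- Subtracting the values at the antipodal points `x₀ ± r v` eliminates the unknown centre `a`.
    refine ContinuousLinearMap.opNorm_le_of_unit_norm (by positivity) fun v hv => ?_
    have h1 := hle (x₀ + r • v) (by simp [norm_smul, hv, abs_of_pos hr])
    have h2 := hle (x₀ - r • v) (by simp [norm_smul, hv, abs_of_pos hr])
    have h3 : (2 * r) • A v = A (x₀ + r • v - a) - A (x₀ - r • v - a) := by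
      rw [← map_smul, ← map_sub]
      congr 1
      module
    have h4 := norm_sub_le (A (x₀ + r • v - a)) (A (x₀ - r • v - a))
    rw [← h3, norm_smul, Real.norm_of_nonneg (by positivity)] at h4
    rw [le_div_iff₀ (by positivity)]
    nlinarith
  have hdet1 : α ≤ C' * |A.det| := by
    rw [div_le_iff₀ hA0] at hvol
    exact hvol.trans (by gcongr; exact le_max_left _ _)
  have hLM : L ≤ M := by
    have h1 := hdetle A _ (by positivity) hAnorm
    have h2 := Real.pow_div_factorial_le_exp L hL0.le (d + 1)
    have h3 : m * Real.exp (-k) * (L ^ (d + 1) / (d + 1).factorial) ≤ C' * (D * (L / (k * r)) ^ d) := by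
      calc _ ≤ m * Real.exp (-k) * Real.exp L := by gcongr
        _ = α := by rw [mul_assoc, ← Real.exp_add, hαL]; congr 2; ring
        _ ≤ _ := hdet1.trans (by gcongr)
    have h4 : L * (L ^ d) ≤ M * L ^ d := by
      calc L * L ^ d = (m * Real.exp (-k) * (L ^ (d + 1) / (d + 1).factorial))
            * ((d + 1).factorial * Real.exp k / m) := by
            rw [Real.exp_neg]; field_simp; ring
        _ ≤ C' * (D * (L / (k * r)) ^ d) * ((d + 1).factorial * Real.exp k / m) := by gcongr
        _ = M * L ^ d := by rw [hM, div_pow]; ring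
    exact le_of_mul_le_mul_right h4 (by positivity)
  have hAT : A ∈ T := ⟨hAnorm.trans (by gcongr), by
    rw [div_le_iff₀ hC'0, mul_comm]
    exact hmα.trans hdet1⟩
  refine ⟨⟨hmα, ?_⟩, hAT, ?_⟩
  · simp only
    rw [hαL]
    gcongr
    linarith
  · have h1 := hcT A hAT (x₀ - a)
    have h2 := hle x₀ (Metric.mem_closedBall_self hr.le)
    simp only [Metric.mem_closedBall]
    rw [dist_comm, dist_eq_norm, le_div_iff₀ hc, le_div_iff₀ hk0]
    nlinarith

lemma continuous_positionFun_param (hψ : Continuous ψ) (x : 𝔼 d) :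
    Continuous fun p => positionFun ψ p x := by
  unfold positionFun
  fun_prop

lemma continuousAt_relVolume {p : ℝ × ((𝔼 d) →L[ℝ] (𝔼 d)) × (𝔼 d)} (hp : IsPositionParam p) :
    ContinuousAt relVolume p := by
  unfold relVolume
  refine ContinuousAt.div (by fun_prop) ?_ (abs_ne_zero.2 hp.2)
  exact (ContinuousLinearMap.continuous_det.comp (by fun_prop)).abs.continuousAt

/-- The minimization problem has a solution as soon as it has a feasible point. -/
lemma exists_isOptimalParam (hψ : IsRadialProfile ψ) {m r : ℝ} (hm : 0 < m) (hr : 0 < r)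
    {x₀ : 𝔼 d} (hf : ∀ x ∈ Metric.closedBall x₀ r, m ≤ f x)
    {q : ℝ × ((𝔼 d) →L[ℝ] (𝔼 d)) × (𝔼 d)} (hq : IsPositionParam q) (hfq : f ≤ positionFun ψ q) :
    ∃ p, IsOptimalParam ψ f p := by
  obtain ⟨S, hS, hSp, hSmem⟩ := exists_isCompact_param hψ hm hr (relVolume q) x₀
  have hclosed : IsClosed {p | f ≤ positionFun ψ p} := by
    simp only [Pi.le_def, Set.ofPred_forall]
    exact isClosed_iInter fun x => isClosed_le continuous_const
      (continuous_positionFun_param hψ.continuous x)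
  have hmem : ∀ p, IsPositionParam p → f ≤ positionFun ψ p → relVolume p ≤ relVolume q →
      p ∈ S ∩ {p | f ≤ positionFun ψ p} := fun p hp hfp hpq =>
    ⟨hSmem p hp hpq fun x hx => (hf x hx).trans (hfp x), hfp⟩
  obtain ⟨p, hp, hmin⟩ := (hS.inter_right hclosed).exists_isMinOn ⟨q, hmem q hq hfq le_rfl⟩
    (f := relVolume) fun p hp => (continuousAt_relVolume (hSp p hp.1)).continuousWithinAt
  refine ⟨p, hSp p hp.1, hp.2, fun q' hq' hfq' => ?_⟩
  rcases le_total (relVolume q') (relVolume q) with h | h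
  · exact hmin (hmem q' hq' hfq' h)
  · exact (show relVolume p ≤ relVolume q from hmin (hmem q hq hfq le_rfl)).trans h

/-! ### Lower bound on a ball and exponential decay of `f` -/

namespace IsProperLogConcave

lemma convex_superlevel (hf : IsProperLogConcave f) {m : ℝ} (hm : 0 ≤ m) :
    Convex ℝ {x | m ≤ f x} := by
  intro x hx y hy a b ha hb hab
  refine le_trans ?_ (hf.logConcave x y a b ha hb hab)
  have hx : m ≤ f x := hx
  have hy : m ≤ f y := hy
  calc m = m ^ a * m ^ b := by
        rw [← Real.rpow_add_of_nonneg hm ha hb, hab, Real.rpow_one]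
    _ ≤ f x ^ a * f y ^ b := by
        have := Real.rpow_nonneg (hf.nonneg x) a
        gcongr

/-- A proper log-concave function is bounded below by a positive constant on some ball. -/
lemma exists_ball_le (hf : IsProperLogConcave f) :
    ∃ (m r : ℝ) (x₀ : 𝔼 d), 0 < m ∧ 0 < r ∧ ∀ x ∈ Metric.closedBall x₀ r, m ≤ f x := by
  by_contra! hcon
  -- Each of these superlevel sets is convex with empty interior, so it lies in its own frontier,
  -- which is null.
  have hnull : ∀ n : ℕ, volume {x | 1 / ((n : ℝ) + 1) ≤ f x} = 0 := fun n => by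
    have hm : (0 : ℝ) < 1 / ((n : ℝ) + 1) := by positivity
    have hconv := hf.convex_superlevel hm.le
    have hint : interior {x | 1 / ((n : ℝ) + 1) ≤ f x} = ∅ := by
      rw [Set.eq_empty_iff_forall_notMem]
      intro x hx
      obtain ⟨r, hr, hsub⟩ := Metric.nhds_basis_closedBall.mem_iff.1 (mem_interior_iff_mem_nhds.1 hx)
      obtain ⟨y, hy, hlt⟩ := hcon _ r x hm hr
      exact hlt.not_ge (hsub hy)
    refine measure_mono_null ?_ (hconv.addHaar_frontier volume)
    rw [frontier, hint, Set.sdiff_empty]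
    exact subset_closure
  have hae : ∀ᵐ x, f x = 0 := by
    rw [ae_iff]
    refine measure_mono_null ?_ (measure_iUnion_null hnull)
    intro x hx
    have hx0 : 0 < f x := (hf.nonneg x).lt_of_ne (Ne.symm hx)
    obtain ⟨n, hn⟩ := exists_nat_one_div_lt hx0
    exact Set.mem_iUnion.2 ⟨n, hn.le⟩
  have h0 : ∫ x, f x = 0 := by
    rw [integral_congr_ae hae, integral_zero]
  exact hf.integral_pos.ne' h0

/-- A proper log-concave function has bounded superlevel sets. -/
lemma exists_forall_lt (hf : IsProperLogConcave f) {m r : ℝ} {x₀ : 𝔼 d} (hm : 0 < m)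
    (hr : 0 < r) (hball : ∀ x ∈ Metric.closedBall x₀ r, m ≤ f x) :
    ∃ R : ℝ, 0 < R ∧ ∀ y, R ≤ ‖y - x₀‖ → f y < m * Real.exp (-1) := by
  set v := (volume (Metric.closedBall (0 : 𝔼 d) (r / 2))).toReal with hv
  have hv0 : 0 < v := ENNReal.toReal_pos
    (Metric.measure_closedBall_pos _ _ (by positivity)).ne' measure_closedBall_lt_top.ne
  set η := m * Real.exp (-1) with hη
  have hη0 : 0 < η := by positivity
  have hηm : η ≤ m := mul_le_of_le_one_right hm.le (Real.exp_le_one_iff.2 (by norm_num))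
  have htend : Tendsto (fun n : ℕ => ∫ x in {x | (n : ℝ) ≤ ‖x - x₀‖}, f x) atTop (𝓝 0) := by
    have h1 := tendsto_setIntegral_of_antitone (μ := volume) (f := f)
      (s := fun n : ℕ => {x : 𝔼 d | (n : ℝ) ≤ ‖x - x₀‖})
      (fun n => (isClosed_le continuous_const (by fun_prop)).measurableSet)
      (fun n k hnk x (hx : (k : ℝ) ≤ ‖x - x₀‖) => (Nat.cast_le.2 hnk).trans hx) ⟨0, hf.integrable.integrableOn⟩
    have h2 : ⋂ n : ℕ, {x : 𝔼 d | (n : ℝ) ≤ ‖x - x₀‖} = ∅ := by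
      rw [Set.eq_empty_iff_forall_notMem]
      intro x hx
      obtain ⟨n, hn⟩ := exists_nat_gt ‖x - x₀‖
      exact hn.not_ge (Set.mem_iInter.1 hx n)
    rwa [h2, setIntegral_empty] at h1
  obtain ⟨n, hn⟩ := (htend.eventually_lt_const (show 0 < η * v by positivity)).exists
  refine ⟨2 * (n + r), by positivity, fun y hy => ?_⟩
  by_contra! hfy
  set z := (1 / 2 : ℝ) • (x₀ + y) with hz
  -- A far point `y` with `f y ≥ η` would force `f ≥ η` on a ball around the midpoint `z`. That ball
  -- lies in the region whose integral is below `η * v`, yet contributes at least `η * v`.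
  have hzball : ∀ x ∈ Metric.closedBall z (r / 2), η ≤ f x ∧ (n : ℝ) ≤ ‖x - x₀‖ := by
    intro x hx
    rw [Metric.mem_closedBall, dist_eq_norm] at hx
    constructor
    · have h1 : η ≤ f (x₀ + (2 : ℝ) • (x - z)) := hηm.trans (hball _ (by
        rw [Metric.mem_closedBall, dist_eq_norm, add_sub_cancel_left, norm_smul,
          Real.norm_of_nonneg zero_le_two]
        linarith))
      have h2 := hf.convex_superlevel hη0.le h1 hfy one_half_pos.le one_half_pos.le (add_halves 1)
      have h3 : (1 / 2 : ℝ) • (x₀ + (2 : ℝ) • (x - z)) + (1 / 2 : ℝ) • y = x := by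
        rw [hz]; module
      rwa [h3] at h2
    · have h1 : ‖z - x₀‖ = ‖y - x₀‖ / 2 := by
        rw [show z - x₀ = (1 / 2 : ℝ) • (y - x₀) by rw [hz]; module, norm_smul,
          Real.norm_of_nonneg one_half_pos.le]
        ring
      have h2 := norm_sub_norm_le (z - x₀) (z - x)
      rw [sub_sub_sub_cancel_left, norm_sub_rev z x] at h2
      linarith
  have hvz : volume.real (Metric.closedBall z (r / 2)) = v := by
    rw [hv, Measure.real, Measure.addHaar_closedBall_center]
  have h1 : η * v ≤ ∫ x in Metric.closedBall z (r / 2), f x := by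
    have h2 := setIntegral_mono_on (μ := volume) (s := Metric.closedBall z (r / 2))
      (f := fun _ => η) (g := f) (integrableOn_const measure_closedBall_lt_top.ne)
      hf.integrable.integrableOn Metric.isClosed_closedBall.measurableSet
      fun x hx => (hzball x hx).1
    rw [setIntegral_const, hvz, smul_eq_mul, mul_comm] at h2
    exact h2
  have h2 : ∫ x in Metric.closedBall z (r / 2), f x ≤ ∫ x in {x | (n : ℝ) ≤ ‖x - x₀‖}, f x :=
    setIntegral_mono_set hf.integrable.integrableOn (ae_of_all _ hf.nonneg)
      (LE.le.eventuallyLE fun x hx => (hzball x hx).2)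
  linarith

/-- A proper log-concave function decays at least exponentially. -/
lemma exists_le_exp (hf : IsProperLogConcave f) : ∃ (C c : ℝ) (x₀ : 𝔼 d), 0 < C ∧ 0 < c ∧
    ∀ x, f x ≤ C * Real.exp (-(c * ‖x - x₀‖)) := by
  obtain ⟨m, r, x₀, hm, hr, hball⟩ := hf.exists_ball_le
  obtain ⟨R, hR, hlt⟩ := hf.exists_forall_lt hm hr hball
  obtain ⟨M, hM⟩ := (hf.upperSemicontinuous.upperSemicontinuousOn
    (Metric.closedBall x₀ R)).bddAbove_of_isCompact (isCompact_closedBall x₀ R)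
  refine ⟨max m (M * Real.exp 1), 1 / R, x₀, lt_max_of_lt_left hm, by positivity, fun y => ?_⟩
  rcases le_total ‖y - x₀‖ R with hy | hy
  · have h1 : f y ≤ M := hM ⟨y, by rwa [Metric.mem_closedBall, dist_eq_norm], rfl⟩
    have h2 : 1 / R * ‖y - x₀‖ ≤ 1 := by
      rw [one_div_mul_eq_div]
      exact div_le_one_of_le₀ hy hR.le
    have h3 : 0 ≤ M := (hf.nonneg y).trans h1
    calc f y ≤ M * Real.exp 1 * Real.exp (-1) := by
          rw [mul_assoc, ← Real.exp_add]; simpa using h1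
      _ ≤ _ := by
        gcongr
        exact le_max_right _ _
  · have hy0 : 0 < ‖y - x₀‖ := hR.trans_le hy
    -- The point of the segment from `x₀` to `y` at distance `R` has value below `m / e`, so
    -- log-concavity gives `f y ≤ m e^(-1/t)`.
    set t := R / ‖y - x₀‖ with ht
    have ht0 : 0 < t := by positivity
    have ht1 : t ≤ 1 := div_le_one_of_le₀ hy hy0.le
    have h1 := hf.logConcave x₀ y (1 - t) t (by linarith) ht0.le (by ring)
    have h2 := hlt ((1 - t) • x₀ + t • y) (by
      rw [show (1 - t) • x₀ + t • y - x₀ = t • (y - x₀) by module, norm_smul,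
        Real.norm_of_nonneg ht0.le, ht, div_mul_cancel₀ _ hy0.ne'])
    have hx₀ : m ≤ f x₀ := hball x₀ (Metric.mem_closedBall_self hr.le)
    have h3 : m ^ (1 - t) * f y ^ t ≤ m * Real.exp (-1) := by
      refine le_trans ?_ (h1.trans h2.le)
      have := Real.rpow_nonneg (hf.nonneg y) t
      gcongr
    have h4 : f y ^ t ≤ (m * Real.exp (-(1 / R * ‖y - x₀‖))) ^ t := by
      rw [Real.mul_rpow hm.le (Real.exp_pos _).le, ← Real.exp_mul,
        show -(1 / R * ‖y - x₀‖) * t = -1 by rw [ht]; field_simp]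
      have h5 : m ^ (1 - t) * m ^ t = m := by
        rw [← Real.rpow_add hm, sub_add_cancel, Real.rpow_one]
      have h6 : 0 < m ^ (1 - t) := Real.rpow_pos_of_pos hm _
      refine le_of_mul_le_mul_left ?_ h6
      rw [← mul_assoc, h5]
      exact h3
    refine ((Real.rpow_le_rpow_iff (hf.nonneg y) (by positivity) ht0).1 h4).trans ?_
    gcongr
    exact le_max_left _ _

end IsProperLogConcave

/-- A suitable multiple of the identity matches the linear upper bound on the profile with the decay
rate of `f`. -/
lemma exists_positionFun_rescaledPsi (hf : IsProperLogConcave f) {s : ℝ} (hs : 0 < s) :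
    ∃ q, IsPositionParam q ∧ f ≤ positionFun (rescaledPsi s) q := by
  obtain ⟨C, c, x₀, hC, hc, hle⟩ := hf.exists_le_exp
  set k := s * √(2 / s) with hk
  have hk0 : 0 < k := by positivity
  refine ⟨(C, (c / k) • ContinuousLinearMap.id ℝ (𝔼 d), x₀), ⟨hC, ?_⟩, fun x => (hle x).trans ?_⟩
  · have h1 : ((c / k) • ContinuousLinearMap.id ℝ (𝔼 d)).det
        = (c / k) ^ Module.finrank ℝ (𝔼 d) * LinearMap.det (LinearMap.id : (𝔼 d) →ₗ[ℝ] (𝔼 d)) :=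
      LinearMap.det_smul _ _
    simp only
    rw [h1, LinearMap.det_id]
    positivity
  · have h1 := rescaledPsi_le_mul hs (norm_nonneg ((c / k) • (x - x₀)))
    rw [norm_smul (c / k), Real.norm_of_nonneg (by positivity), ← hk,
      show k * (c / k * ‖x - x₀‖) = c * ‖x - x₀‖ by field_simp] at h1
    simp only [positionFun, _root_.smul_apply, ContinuousLinearMap.id_apply, norm_smul,
      Real.norm_of_nonneg (show 0 ≤ c / k by positivity)]
    gcongr

/-! ### Limits of positions as `s → ∞` -/

section Convergence

lemma tendsto_rescaledPsi {s t : ℕ → ℝ} {t₀ : ℝ} (hs0 : ∀ n, 1 ≤ s n)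
    (hs : Tendsto s atTop atTop) (ht0 : ∀ n, 0 ≤ t n) (ht : Tendsto t atTop (𝓝 t₀)) :
    Tendsto (fun n => rescaledPsi (s n) (t n)) atTop (𝓝 (t₀ ^ 2)) := by
  have h1 : Tendsto (fun n => t n ^ 2 - t n ^ 4 / s n) atTop (𝓝 (t₀ ^ 2 - 0)) :=
    (ht.pow 2).sub ((ht.pow 4).div_atTop hs)
  rw [sub_zero] at h1
  exact tendsto_of_tendsto_of_tendsto_of_le_of_le h1 (ht.pow 2)
    (fun n => sq_sub_le_rescaledPsi (one_pos.trans_le (hs0 n)) (ht0 n))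
    (fun n => rescaledPsi_le_sq (one_pos.trans_le (hs0 n)) (ht0 n))

variable {s : ℕ → ℝ} {p : ℕ → ℝ × ((𝔼 d) →L[ℝ] (𝔼 d)) × (𝔼 d)}
  {q : ℝ × ((𝔼 d) →L[ℝ] (𝔼 d)) × (𝔼 d)}

lemma tendsto_positionFun_rescaledPsi (hs0 : ∀ n, 1 ≤ s n) (hs : Tendsto s atTop atTop)
    (hp : Tendsto p atTop (𝓝 q)) {x : ℕ → 𝔼 d} {x₀ : 𝔼 d} (hx : Tendsto x atTop (𝓝 x₀)) :
    Tendsto (fun n => positionFun (rescaledPsi (s n)) (p n) (x n)) atTop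
      (𝓝 (positionFun (fun t => t ^ 2) q x₀)) := by
  have hA : Tendsto (fun n => (p n).2.1) atTop (𝓝 q.2.1) := hp.snd_nhds.fst_nhds
  have h1 : Tendsto (fun n => ‖(p n).2.1 (x n - (p n).2.2)‖) atTop (𝓝 ‖q.2.1 (x₀ - q.2.2)‖) :=
    ((isBoundedBilinearMap_apply.continuous.tendsto (q.2.1, x₀ - q.2.2)).comp
      (hA.prodMk_nhds (hx.sub hp.snd_nhds.snd_nhds))).norm
  have h2 := tendsto_rescaledPsi hs0 hs (fun n => norm_nonneg _) h1
  exact hp.fst_nhds.mul ((Real.continuous_exp.tendsto _).comp h2.neg)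

/-- Positions with converging parameters vanish at infinity, uniformly. -/
lemma tendsto_positionFun_zero (hψ : IsRadialProfile ψ) {Ψ : ℕ → ℝ → ℝ}
    (hΨ : ∀ n t, 0 ≤ t → ψ t ≤ Ψ n t) (hp0 : ∀ n, IsPositionParam (p n)) (hq : IsPositionParam q)
    (hp : Tendsto p atTop (𝓝 q)) {x : ℕ → 𝔼 d} (hx : Tendsto (fun n => ‖x n‖) atTop atTop) :
    Tendsto (fun n => positionFun (Ψ n) (p n) (x n)) atTop (𝓝 0) := by
  -- A convergent sequence together with its limit is compact, so all the linear maps share one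
  -- lower bound.
  obtain ⟨c, hc, hcle⟩ := (hp.isCompact_insert_range.image
    (f := fun z : ℝ × ((𝔼 d) →L[ℝ] (𝔼 d)) × (𝔼 d) => z.2.1) (by fun_prop)).exists_forall_mul_norm_le
    (by
      rintro _ ⟨z, rfl | ⟨n, rfl⟩, rfl⟩
      exacts [hq.2, (hp0 n).2])
  have hlow : ∀ n, c * (‖x n‖ - ‖(p n).2.2‖) ≤ ‖(p n).2.1 (x n - (p n).2.2)‖ := fun n => by
    refine le_trans ?_ (hcle _ ⟨p n, Or.inr ⟨n, rfl⟩, rfl⟩ _)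
    gcongr
    exact norm_sub_norm_le _ _
  have hcenter : Tendsto (fun n => -‖(p n).2.2‖) atTop (𝓝 (-‖q.2.2‖)) :=
    hp.snd_nhds.snd_nhds.norm.neg
  have htop : Tendsto (fun n => ‖(p n).2.1 (x n - (p n).2.2)‖) atTop atTop :=
    tendsto_atTop_mono hlow ((hx.atTop_add hcenter).const_mul_atTop hc)
  have hk := hψ.pos one_pos
  have hexp : Tendsto (fun n => Real.exp (-(ψ 1 * ‖(p n).2.1 (x n - (p n).2.2)‖ + -ψ 1)))
      atTop (𝓝 0) :=
    Real.tendsto_exp_neg_atTop_nhds_zero.comp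
      ((htop.const_mul_atTop hk).atTop_add tendsto_const_nhds)
  have hmul := hp.fst_nhds.mul hexp
  rw [mul_zero] at hmul
  refine squeeze_zero (fun n => ?_) (fun n => ?_) hmul
  · exact mul_nonneg (hp0 n).1.le (Real.exp_pos _).le
  · refine mul_le_mul_of_nonneg_left (Real.exp_le_exp.2 ?_) (hp0 n).1.le
    have h1 := hψ.linear_le (norm_nonneg ((p n).2.1 (x n - (p n).2.2)))
    have h2 := hΨ n _ (norm_nonneg ((p n).2.1 (x n - (p n).2.2)))
    linarith

/-- If uniformity fails, take bad points `x n`. Along a bounded subsequence both functions have the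
same limit by joint continuity; if the points escape to infinity, both values tend to `0`. -/
lemma tendstoUniformly_positionFun (hs0 : ∀ n, 1 ≤ s n) (hs : Tendsto s atTop atTop)
    (hp0 : ∀ n, IsPositionParam (p n)) (hq : IsPositionParam q) (hp : Tendsto p atTop (𝓝 q)) :
    TendstoUniformly (fun n => positionFun (rescaledPsi (s n)) (p n))
      (positionFun (fun t => t ^ 2) q) atTop := by
  rw [Metric.tendstoUniformly_iff]
  by_contra! hcon
  obtain ⟨ε, hε, hfreq⟩ := hcon
  obtain ⟨φ, hφ, hex⟩ := extraction_of_frequently_atTop hfreq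
  choose x hx using hex
  have hφt := hφ.tendsto_atTop
  have key : ∀ θ : ℕ → ℕ, ∀ y : ℝ,
      Tendsto (fun n => positionFun (fun t => t ^ 2) q (x (θ n))) atTop (𝓝 y) →
      Tendsto (fun n => positionFun (rescaledPsi (s (φ (θ n)))) (p (φ (θ n))) (x (θ n))) atTop
        (𝓝 y) → False := by
    intro θ y h1 h2
    have h3 := h1.dist h2
    rw [dist_self] at h3
    exact absurd (ge_of_tendsto' h3 fun n => hx (θ n)) hε.not_ge
  by_cases hb : ∃ R, ∃ᶠ n in atTop, x n ∈ Metric.closedBall (0 : 𝔼 d) R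
  · obtain ⟨R, hR⟩ := hb
    obtain ⟨x₀, -, θ, hθ, hlim⟩ := tendsto_subseq_of_frequently_bounded
      Metric.isBounded_closedBall hR
    have hθt := hφt.comp hθ.tendsto_atTop
    refine key θ (positionFun (fun t => t ^ 2) q x₀) ?_ ?_
    · exact ((continuous_positionFun (by fun_prop) q).tendsto x₀).comp hlim
    · exact tendsto_positionFun_rescaledPsi (fun n => hs0 _) (hs.comp hθt) (hp.comp hθt) hlim
  · push Not at hb
    have hxt : Tendsto (fun n => ‖x n‖) atTop atTop := tendsto_atTop.2 fun R => by
      filter_upwards [hb R] with n hn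
      simpa using (lt_of_not_ge (by simpa using hn)).le
    refine key id 0 ?_ ?_
    · exact tendsto_positionFun_zero IsRadialProfile.sq (Ψ := fun _ t => t ^ 2)
        (fun _ _ _ => le_rfl) (fun _ => hq) hq tendsto_const_nhds hxt
    · exact tendsto_positionFun_zero (isRadialProfile_rescaledPsi one_pos)
        (Ψ := fun n => rescaledPsi (s (φ n)))
        (fun n t ht => rescaledPsi_mono one_pos (hs0 _) ht) (fun n => hp0 _) hq (hp.comp hφt) hxt

/-- Feasible positions of bounded relative volume subconverge to a feasible Gaussian. -/
lemma IsProperLogConcave.exists_subseq (hf : IsProperLogConcave f) (hs0 : ∀ n, 1 ≤ s n)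
    (hs : Tendsto s atTop atTop) (hp : ∀ n, IsPositionParam (p n))
    (hfp : ∀ n, f ≤ positionFun (rescaledPsi (s n)) (p n)) {C : ℝ}
    (hC : ∀ n, relVolume (p n) ≤ C) :
    ∃ q, IsPositionParam q ∧ f ≤ positionFun (fun t => t ^ 2) q ∧ relVolume q ≤ C ∧
      ∃ φ : ℕ → ℕ, StrictMono φ ∧ Tendsto (p ∘ φ) atTop (𝓝 q) := by
  obtain ⟨m, r, x₀, hm, hr, hball⟩ := hf.exists_ball_le
  -- Since `s n ≥ 1`, every position lies below the one with profile `rescaledPsi 1` and the same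
  -- parameters, so one compact set serves all `n`.
  obtain ⟨S, hS, hSp, hSmem⟩ :=
    exists_isCompact_param (isRadialProfile_rescaledPsi one_pos) hm hr C x₀
  have hpS : ∀ n, p n ∈ S := fun n => hSmem _ (hp n) (hC n) fun x hx => by
    refine (hball x hx).trans ((hfp n x).trans ?_)
    refine mul_le_mul_of_nonneg_left (Real.exp_le_exp.2 (neg_le_neg ?_)) (hp n).1.le
    exact rescaledPsi_mono one_pos (hs0 n) (norm_nonneg _)
  obtain ⟨q, hqS, φ, hφ, hlim⟩ := hS.tendsto_subseq hpS
  refine ⟨q, hSp q hqS, fun x => ?_, ?_, φ, hφ, hlim⟩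
  · exact ge_of_tendsto' (tendsto_positionFun_rescaledPsi (fun n => hs0 (φ n))
      (hs.comp hφ.tendsto_atTop) hlim (tendsto_const_nhds (x := x))) fun n => hfp (φ n) x
  · exact le_of_tendsto' ((continuousAt_relVolume (hSp q hqS)).tendsto.comp hlim)
      fun n => hC (φ n)

end Convergence

/-! ### Löwner functions and the equivalences -/

lemma IsProperLogConcave.existsUnique_isLownerSolution (hf : IsProperLogConcave f) {s : ℝ≥0∞}
    (h : positionClass d (lownerPsi s) = positionClass d ψ) (hψ : IsRadialProfile ψ)
    {q : ℝ × ((𝔼 d) →L[ℝ] (𝔼 d)) × (𝔼 d)} (hq : IsPositionParam q) (hfq : f ≤ positionFun ψ q) :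
    ∃! l, IsLownerSolution s f l := by
  obtain ⟨m, r, x₀, hm, hr, hball⟩ := hf.exists_ball_le
  obtain ⟨p, hp⟩ := exists_isOptimalParam hψ hm hr hball hq hfq
  refine ⟨positionFun ψ p, (isLownerSolution_iff h hψ).2 ⟨p, hp, rfl⟩, fun l hl => ?_⟩
  obtain ⟨p', hp', rfl⟩ := (isLownerSolution_iff h hψ).1 hl
  exact hp'.positionFun_eq hψ hp

lemma IsProperLogConcave.existsUnique_isLownerSolution_coe (hf : IsProperLogConcave f) {s : ℝ≥0}
    (hs : 0 < s) : ∃! l, IsLownerSolution (s : ℝ≥0∞) f l := by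
  obtain ⟨q, hq, hfq⟩ := exists_positionFun_rescaledPsi hf (s := s) hs
  exact hf.existsUnique_isLownerSolution (positionClass_lownerPsi hs)
    (isRadialProfile_rescaledPsi hs) hq hfq

lemma IsProperLogConcave.exists_lownerFunction_eq (hf : IsProperLogConcave f) {s : ℝ≥0}
    (hs : 0 < s) :
    ∃ p, IsOptimalParam (rescaledPsi s) f p ∧ lownerFunction s f = positionFun (rescaledPsi s) p :=
  (isLownerSolution_iff (positionClass_lownerPsi hs) (isRadialProfile_rescaledPsi hs)).1
    (Classical.epsilon_spec (hf.existsUnique_isLownerSolution_coe hs).exists)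

lemma positionFun_mono {φ : ℝ → ℝ} (hφψ : ∀ t, 0 ≤ t → φ t ≤ ψ t)
    {q : ℝ × ((𝔼 d) →L[ℝ] (𝔼 d)) × (𝔼 d)} (hq : IsPositionParam q) :
    positionFun ψ q ≤ positionFun φ q := fun _ =>
  mul_le_mul_of_nonneg_left (Real.exp_le_exp.2 (neg_le_neg (hφψ _ (norm_nonneg _)))) hq.1.le

lemma profileMass_mono {φ : ℝ → ℝ} (hφψ : ∀ t, 0 ≤ t → φ t ≤ ψ t) :
    profileMass d ψ ≤ profileMass d φ :=
  lintegral_mono fun _ => ENNReal.ofReal_le_ofReal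
    (Real.exp_le_exp.2 (neg_le_neg (hφψ _ (norm_nonneg _))))

/-- The relative volume of the Löwner `s`-function is at most that of any Gaussian above `f`. -/
lemma IsOptimalParam.relVolume_le {s : ℝ} (hs : 0 < s)
    {p q : ℝ × ((𝔼 d) →L[ℝ] (𝔼 d)) × (𝔼 d)} (hp : IsOptimalParam (rescaledPsi s) f p)
    (hq : IsPositionParam q) (hfq : f ≤ positionFun (fun t => t ^ 2) q) :
    relVolume p ≤ relVolume q :=
  hp.minimal q hq (hfq.trans (positionFun_mono (fun _ ht => rescaledPsi_le_sq hs ht) hq))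

lemma IsProperLogConcave.exists_gaussian_of_liminf_lt_top (hf : IsProperLogConcave f)
    (h : liminf (fun s : ℝ≥0 => ∫⁻ x, ENNReal.ofReal (lownerFunction s f x)) atTop < ∞) :
    ∃ q, IsPositionParam q ∧ f ≤ positionFun (fun t => t ^ 2) q := by
  obtain ⟨b, hb, hbtop⟩ := exists_between h
  obtain ⟨s, hs, hsp⟩ := exists_seq_forall_of_frequently
    ((frequently_lt_of_liminf_lt (by isBoundedDefault) hb).and_eventually (eventually_ge_atTop 1))
  have hs0 : ∀ n, 0 < s n := fun n => one_pos.trans_le (hsp n).2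
  choose p hp hpeq using fun n => hf.exists_lownerFunction_eq (hs0 n)
  have hmass0 := profileMass_ne_zero (d := d) IsRadialProfile.sq.continuous
  obtain ⟨q, hq, hfq, -⟩ := hf.exists_subseq (s := fun n => (s n : ℝ)) (p := p)
    -- The mass of each `rescaledPsi` is at least the Gaussian mass, so dividing the bound `b` by
    -- the latter bounds all relative volumes.
    (C := (b / profileMass d fun t => t ^ 2).toReal)
    (fun n => by exact_mod_cast (hsp n).2) (NNReal.tendsto_coe_atTop.2 hs)
    (fun n => (hp n).isPositionParam) (fun n => (hp n).le) fun n => by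
      have h1 := (hsp n).1.le
      rw [hpeq, lintegral_positionFun (isRadialProfile_rescaledPsi (NNReal.coe_pos.2 (hs0 n))).continuous
        (hp n).isPositionParam] at h1
      have h2 := (mul_le_mul_right (profileMass_mono (d := d)
        fun t ht => rescaledPsi_le_sq (s := s n) (hs0 n) ht) _).trans h1
      rw [← ENNReal.le_div_iff_mul_le (Or.inl hmass0)
        (Or.inl (profileMass_ne_top IsRadialProfile.sq))] at h2
      exact (ENNReal.ofReal_le_iff_le_toReal (ENNReal.div_ne_top hbtop.ne hmass0)).1 h2
  exact ⟨q, hq, hfq⟩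

lemma IsProperLogConcave.liminf_lt_top (hf : IsProperLogConcave f)
    {q : ℝ × ((𝔼 d) →L[ℝ] (𝔼 d)) × (𝔼 d)} (hq : IsPositionParam q)
    (hfq : f ≤ positionFun (fun t => t ^ 2) q) :
    liminf (fun s : ℝ≥0 => ∫⁻ x, ENNReal.ofReal (lownerFunction s f x)) atTop < ∞ := by
  refine lt_of_le_of_lt (liminf_le_of_frequently_le' (x := ENNReal.ofReal (relVolume q) *
    profileMass d (rescaledPsi 1)) (Eventually.frequently ?_)) (ENNReal.mul_lt_top
      ENNReal.ofReal_lt_top (profileMass_ne_top (isRadialProfile_rescaledPsi one_pos)).lt_top)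
  filter_upwards [eventually_ge_atTop 1] with s hs
  have hs0 : 0 < s := one_pos.trans_le hs
  obtain ⟨p, hp, hpeq⟩ := hf.exists_lownerFunction_eq hs0
  rw [hpeq, lintegral_positionFun (isRadialProfile_rescaledPsi (NNReal.coe_pos.2 hs0)).continuous hp.isPositionParam]
  exact mul_le_mul' (ENNReal.ofReal_le_ofReal (hp.relVolume_le hs0 hq hfq))
    (profileMass_mono fun t ht => rescaledPsi_mono one_pos (by exact_mod_cast hs) ht)

/-- Along a sequence violating uniform convergence, the parameters subconverge to a feasible
Gaussian of volume at most that of `G`. It is then optimal, so it equals `G` by uniqueness, and the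
subsequence converges uniformly to `G`, a contradiction. -/
lemma IsProperLogConcave.tendstoUniformly_lownerFunction (hf : IsProperLogConcave f)
    {G : (𝔼 d) → ℝ} (hG : IsLownerSolution ∞ f G) :
    TendstoUniformly (fun s : ℝ≥0 => lownerFunction s f) G atTop := by
  obtain ⟨g, hg, rfl⟩ :=
    (isLownerSolution_iff (congrArg _ lownerPsi_top) IsRadialProfile.sq).1 hG
  rw [Metric.tendstoUniformly_iff]
  by_contra! hcon
  obtain ⟨ε, hε, hfreq⟩ := hcon
  obtain ⟨s, hs, hsp⟩ := exists_seq_forall_of_frequently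
    (hfreq.and_eventually (eventually_ge_atTop 1))
  have hs0 : ∀ n, 0 < s n := fun n => one_pos.trans_le (hsp n).2
  have hs1 : ∀ n, (1 : ℝ) ≤ s n := fun n => by exact_mod_cast (hsp n).2
  have hst : Tendsto (fun n => (s n : ℝ)) atTop atTop := NNReal.tendsto_coe_atTop.2 hs
  choose p hp hpeq using fun n => hf.exists_lownerFunction_eq (hs0 n)
  obtain ⟨q, hq, hfq, hqg, φ, hφ, hlim⟩ := hf.exists_subseq (s := fun n => (s n : ℝ)) (p := p)
    (C := relVolume g) hs1 hst (fun n => (hp n).isPositionParam) (fun n => (hp n).le)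
    fun n => (hp n).relVolume_le (hs0 n) hg.isPositionParam hg.le
  have hqopt : IsOptimalParam (fun t => t ^ 2) f q :=
    ⟨hq, hfq, fun q' hq' hfq' => hqg.trans (hg.minimal q' hq' hfq')⟩
  have hunif := tendstoUniformly_positionFun (fun n => hs1 (φ n)) (hst.comp hφ.tendsto_atTop)
    (fun n => (hp (φ n)).isPositionParam) hq hlim
  rw [hqopt.positionFun_eq IsRadialProfile.sq hg, Metric.tendstoUniformly_iff] at hunif
  obtain ⟨n, hn⟩ := (hunif ε hε).exists
  obtain ⟨x, hx⟩ := (hsp (φ n)).1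
  rw [hpeq] at hx
  exact hx.not_gt (hn x)

theorem theorem1p4 (d : ℕ) (f : EuclideanSpace ℝ (Fin d) → ℝ) (hf : IsProperLogConcave f) :
    -- for every `s ∈ (0, ∞)` the Löwner `s`-function exists and is unique
    (∀ s : ℝ≥0, 0 < s → ∃! l : EuclideanSpace ℝ (Fin d) → ℝ, IsLownerSolution (s : ℝ≥0∞) f l) ∧
    List.TFAE [
      Filter.liminf (fun s : ℝ≥0 => ∫⁻ x, ENNReal.ofReal (lownerFunction s f x)) Filter.atTop < ∞,
      ∃ G ∈ gaussianDensities d, f ≤ G,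
      ∃! G : EuclideanSpace ℝ (Fin d) → ℝ, IsLownerSolution ∞ f G] ∧
    (∀ G : EuclideanSpace ℝ (Fin d) → ℝ, IsLownerSolution ∞ f G →
      TendstoUniformly (fun s : ℝ≥0 => lownerFunction s f) G Filter.atTop) := by
  refine ⟨fun s hs => hf.existsUnique_isLownerSolution_coe hs, ?_,
    fun G hG => hf.tendstoUniformly_lownerFunction hG⟩
  have hgauss : (∃ G ∈ gaussianDensities d, f ≤ G) ↔
      ∃ q, IsPositionParam q ∧ f ≤ positionFun (fun t => t ^ 2) q := by
    rw [gaussianDensities, lownerPsi_top]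
    constructor
    · rintro ⟨G, hG, hfG⟩
      obtain ⟨q, hq, rfl⟩ := mem_positionClass_iff.1 hG
      exact ⟨q, hq, hfG⟩
    · rintro ⟨q, hq, hfq⟩
      exact ⟨_, mem_positionClass_iff.2 ⟨q, hq, rfl⟩, hfq⟩
  rw [hgauss]
  tfae_have 1 → 2 := hf.exists_gaussian_of_liminf_lt_top
  tfae_have 2 → 1 := fun ⟨q, hq, hfq⟩ => hf.liminf_lt_top hq hfq
  tfae_have 2 → 3 := fun ⟨q, hq, hfq⟩ =>
    hf.existsUnique_isLownerSolution (congrArg _ lownerPsi_top) IsRadialProfile.sq hq hfq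
  tfae_have 3 → 2 := fun ⟨G, hG, _⟩ => hgauss.1 ⟨G, hG.mem, hG.le⟩
  tfae_finish
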